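/- Let $g \ge 1$ and let $F_{g,1}$ be the free group with basis $t_1, x_1, \ldots, x_g, y_1, \ldots, y_g$. For elements $u, v$ of a group, put $[u,v] := u^{-1}v^{-1}uv$. Let $A_{g,1}$ be the group of all automorphisms of $F_{g,1}$ that fix the element $t_1\,[x_1,y_1][x_2,y_2]\cdots[x_g,y_g]$ and map the conjugacy class of $t_1$ to itself. Let $\mathrm{Stab}(t_1; A_{g,1})$ be the subgroup of those $\phi \in A_{g,1}$ that fix $t_1$, and let $\gamma_1$ be the automorphism of $F_{g,1}$ given by $$t_1 \mapsto w_1^{-1} t_1 w_1, \qquad x_1 \mapsto x_1 w_1, \qquad\text{where } w_1 := t_1 x_1^{-1} y_1^{-1} x_1,$$ and fixing $x_2, \ldots, x_g$ and $y_1, \ldots, y_g$. Then $\gamma_1 \in A_{g,1}$, and the group $A_{g,1}$ is generated by $\mathrm{Stab}(t_1; A_{g,1}) \cup \{\gamma_1\}$. -/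

import Mathlib

namespace AlgMCG

/-- The distinguished generators `t_1, …, t_p`, `x_1, …, x_g`, `y_1, …, y_g`.
The indices are shifted by one: `t j`, `x i`, `y i` stand for `t_{j+1}`, `x_{i+1}`, `y_{i+1}`. -/
inductive Gen (g p : ℕ) : Type
  | t (j : Fin p) : Gen g p
  | x (i : Fin g) : Gen g p
  | y (i : Fin g) : Gen g p

/-- The free group `F_{g,p}` on `t_1, …, t_p, x_1, …, x_g, y_1, …, y_g`. -/
abbrev F (g p : ℕ) : Type := FreeGroup (Gen g p)

/-- The basis element `t_{j+1}` of `F_{g,p}`. -/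
def tt {g p : ℕ} (j : Fin p) : F g p := FreeGroup.of (Gen.t j)

/-- The basis element `x_{i+1}` of `F_{g,p}`. -/
def xx {g p : ℕ} (i : Fin g) : F g p := FreeGroup.of (Gen.x i)

/-- The basis element `y_{i+1}` of `F_{g,p}`. -/
def yy {g p : ℕ} (i : Fin g) : F g p := FreeGroup.of (Gen.y i)

/-- The commutator in the convention `[u, v] = u⁻¹ v⁻¹ u v`
(Mathlib's `⁅u, v⁆` is `u v u⁻¹ v⁻¹`). -/
def comm {G : Type*} [Group G] (u v : G) : G := u⁻¹ * v⁻¹ * u * v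

/-- The element `(t_p ⋯ t_2 t_1) ([x_1, y_1] [x_2, y_2] ⋯ [x_g, y_g])` of `F_{g,p}`. -/
def V₀ (g p : ℕ) : F g p :=
  (List.ofFn fun j : Fin p => (tt j : F g p)).reverse.prod *
    (List.ofFn fun i : Fin g => comm (xx i : F g p) (yy i)).prod

/-- The set `{[t_1], …, [t_p]}` of conjugacy classes of `F_{g,p}`. -/
def tClasses (g p : ℕ) : Set (ConjClasses (F g p)) :=
  Set.range fun j : Fin p => ConjClasses.mk (tt j)

/-- The group `A_{g,p}` of all automorphisms of `F_{g,p}` which fix `V₀` and permute the set of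
conjugacy classes `{[t_1], …, [t_p]}`. -/
def A (g p : ℕ) : Subgroup (MulAut (F g p)) where
  carrier := {φ | φ (V₀ g p) = V₀ g p ∧
    ConjClasses.map φ.toMonoidHom '' tClasses g p = tClasses g p}
  one_mem' := by
    refine ⟨rfl, ?_⟩
    have h : ConjClasses.map (1 : MulAut (F g p)).toMonoidHom = id := by
      funext c
      induction c using Quotient.inductionOn
      rfl
    rw [h, Set.image_id]
  mul_mem' := by
    rintro φ ψ ⟨h1, h2⟩ ⟨k1, k2⟩
    refine ⟨by rw [MulAut.mul_apply, k1, h1], ?_⟩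
    have h : ConjClasses.map (φ * ψ).toMonoidHom =
        ConjClasses.map φ.toMonoidHom ∘ ConjClasses.map ψ.toMonoidHom := by
      funext c
      induction c using Quotient.inductionOn
      rfl
    rw [h, Set.image_comp, k2, h2]
  inv_mem' := by
    rintro φ ⟨h1, h2⟩
    refine ⟨?_, ?_⟩
    · conv_lhs => rw [← h1]
      exact MulAut.inv_apply_self _ φ _
    · have h : ConjClasses.map (φ⁻¹).toMonoidHom ∘ ConjClasses.map φ.toMonoidHom = id := by
        funext c
        induction c using Quotient.inductionOn with
        | h a => exact congrArg ConjClasses.mk (MulAut.inv_apply_self _ φ a)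
      conv_lhs => rw [← h2]
      rw [← Set.image_comp, h, Set.image_id]

/-- `Stab(u; A_{g,p})`, the subgroup of those elements of `A_{g,p}` which fix `u ∈ F_{g,p}`. -/
def stabA {g p : ℕ} (u : F g p) : Subgroup (MulAut (F g p)) :=
  A g p ⊓ MulAction.stabilizer (MulAut (F g p)) u

section gamma

variable {g p : ℕ} (hg : 1 ≤ g) (hp : 1 ≤ p)

/-- The element `w_1 = t_1 x_1⁻¹ y_1⁻¹ x_1` of `F_{g,p}`, where `g, p ≥ 1`. -/
def w₁ : F g p := tt ⟨0, hp⟩ * (xx ⟨0, hg⟩)⁻¹ * (yy ⟨0, hg⟩)⁻¹ * xx ⟨0, hg⟩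

/-- The endomorphism of `F_{g,p}` with `t_1 ↦ w⁻¹ t_1 w` and `x_1 ↦ x_1 w` which fixes all the
other generators. -/
def gammaHom (w : F g p) : F g p →* F g p :=
  FreeGroup.lift fun
    | .t j => if j.val = 0 then w⁻¹ * tt j * w else tt j
    | .x i => if i.val = 0 then xx i * w else xx i
    | .y i => yy i

theorem gammaHom_w₁ (w : F g p) (hw : Commute w (w₁ hg hp)) :
    gammaHom w (w₁ hg hp) = w₁ hg hp := by
  have h : gammaHom w (w₁ hg hp) = w⁻¹ * w₁ hg hp * w := by
    simp [gammaHom, w₁, tt, xx, yy, mul_assoc]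
  rw [h, mul_assoc, ← hw.eq, inv_mul_cancel_left]

theorem gammaHom_comp (w : F g p) (v : F g p) (hv : gammaHom w v = v) (hvw : w * v = 1) :
    (gammaHom w).comp (gammaHom v) = MonoidHom.id _ := by
  obtain rfl : w = v⁻¹ := eq_inv_of_mul_eq_one_left hvw
  refine FreeGroup.ext_hom _ _ fun a => ?_
  rw [MonoidHom.comp_apply]
  rcases a with j | i | i
  · by_cases h : j.val = 0
    · have e : gammaHom v (FreeGroup.of (Gen.t j)) = v⁻¹ * tt j * v := by
        simp [gammaHom, h]
      rw [e, map_mul, map_mul, map_inv, hv]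
      simp [gammaHom, h, tt, mul_assoc]
    · simp [gammaHom, h, tt]
  · by_cases h : i.val = 0
    · have e : gammaHom v (FreeGroup.of (Gen.x i)) = xx i * v := by
        simp [gammaHom, h]
      rw [e, map_mul, hv]
      simp [gammaHom, h, xx]
    · simp [gammaHom, h, xx]
  · simp [gammaHom, yy]

/-- The automorphism `γ_1` of `F_{g,p}`, for `g, p ≥ 1`, with `t_1 ↦ w_1⁻¹ t_1 w_1` and
`x_1 ↦ x_1 w_1` which fixes all the other generators. -/
def γ₁ : MulAut (F g p) :=
  (gammaHom (w₁ hg hp)).toMulEquiv (gammaHom (w₁ hg hp)⁻¹)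
    (gammaHom_comp _ _ (gammaHom_w₁ hg hp _ (Commute.refl _).inv_left) (inv_mul_cancel _))
    (gammaHom_comp _ _ (by rw [map_inv, gammaHom_w₁ hg hp _ (Commute.refl _)])
      (mul_inv_cancel _))

end gamma

end AlgMCG

/-! Let G be the subgroup generated by the stabilizer and γ₁. Since G contains the stabilizer of t₁
in A, an element φ of A lies in G as soon as φ(t₁) lies in the G-orbit of t₁
(`mem_genA_of_inOrbit`). So only the orbit of t₁ matters.

The argument runs over a larger class than A, the markings (β, V). The word V says how a
one-boundary surface is glued from a polygon, and β(V) = V₀. If V = P t₁ Q, sliding t₁ to the front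
gives the element β(P t₁ P⁻¹), the front arc; for V equal to the word of V₀ it is β(t₁). The claim
`IsMarking.frontInOrbit` is that every front arc lies in the orbit.

The claim is proved by Nielsen reduction on `totalWeight`: length first, then codes of half-words to
break ties. A move multiplies a letter of V by a neighbour, or conjugates t₁ by a neighbour, and
rearranges V so that β(V) is still V₀. The front arc changes only when t₁ is absorbed into a
neighbouring letter a; it then jumps to the other occurrence of a. The change is conjugation by a
loop c, or by (front arc) · c, up to inverses, where c runs around the pair a, a⁻¹. By the
classification of surfaces (`IsMarking.exists_linked`, `IsMarking.exists_next_handle`,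
`exists_mem_A`) some θ in A takes t₁ to the front arc and x₁⁻¹y₁⁻¹x₁ to β(c). Hence the change is
the effect of θ γ₁^{±1} in place of θ, and it does not affect membership in the orbit
(`IsMarking.inOrbit_conj_iff`).

When no move lowers the weight, no factor of β(V) cancels totally. As V and V₀ have the same number
of letters, each factor contributes exactly one letter to V₀. The factor β(t₁) = U t₁ U⁻¹
contributes its middle letter t₁, which stands first in V₀. So t₁ is first in V, nothing cancels to
its left, U is empty and β(t₁) = t₁ (`IsMarking.frontInOrbit_of_not_reducible`). -/

namespace AlgMCG

/-! ### Reduced words and cancellation in free groups -/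

section cancellationInWords

open FreeGroup

section words

variable {α : Type*} [DecidableEq α]

theorem toWord_mk_of_isReduced {L : List (α × Bool)} (h : IsReduced L) : (mk L).toWord = L := by
  rw [toWord_mk, h.reduce_eq]

theorem toWord_mk_of_length_le_norm {L : List (α × Bool)} (h : L.length ≤ FreeGroup.norm (mk L)) :
    (mk L).toWord = L := by
  have hs : List.Sublist (reduce L) L := reduce.red.sublist
  rw [toWord_mk]
  refine hs.eq_of_length_le ?_
  simpa [FreeGroup.norm] using h

theorem norm_eq_of_toWord {w : FreeGroup α} {L : List (α × Bool)} (h : w.toWord = L) :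
    FreeGroup.norm w = L.length := by rw [FreeGroup.norm, h]

/-- The cancellation in a product of two reduced words. -/
theorem exists_cancellation (a b : FreeGroup α) : ∃ p A B : List (α × Bool),
    a.toWord = A ++ invRev p ∧ b.toWord = p ++ B ∧ (a * b).toWord = A ++ B := by
  suffices H : ∀ (n : ℕ) (U W : List (α × Bool)), U.length = n → IsReduced U → IsReduced W →
      ∃ p A B : List (α × Bool), U = A ++ invRev p ∧ W = p ++ B ∧ reduce (U ++ W) = A ++ B by
    obtain ⟨p, A, B, h1, h2, h3⟩ := H _ a.toWord b.toWord rfl isReduced_toWord isReduced_toWord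
    exact ⟨p, A, B, h1, h2, by rw [toWord_mul, h3]⟩
  intro n
  induction n with
  | zero =>
    intro U W hU _ hW
    obtain rfl := List.length_eq_zero_iff.1 hU
    exact ⟨[], [], W, by simp, by simp, by simpa using hW.reduce_eq⟩
  | succ n ih =>
    intro U W hU hU' hW
    by_cases hred : IsReduced (U ++ W)
    · exact ⟨[], U, W, by simp, by simp, hred.reduce_eq⟩
    · obtain ⟨U₀, x, rfl⟩ : ∃ U₀ x, U = U₀ ++ [x] := by
        rcases List.eq_nil_or_concat U with rfl | ⟨U₀, x, rfl⟩
        · simp at hU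
        · exact ⟨U₀, x, by simp⟩
      rcases W with _ | ⟨y, W⟩
      · exact absurd (by simpa using hU') hred
      have hxy : y = (x.1, !x.2) := by
        by_contra hne
        refine hred ?_
        rw [show U₀ ++ [x] ++ y :: W = U₀ ++ [x] ++ (y :: W) by simp]
        refine IsReduced.append_overlap hU' ?_ (by simp)
        rw [List.singleton_append, isReduced_cons_cons]
        refine ⟨fun h => ?_, hW⟩
        by_contra h2
        refine hne (Prod.ext h.symm ?_)
        revert h2
        cases x.2 <;> cases y.2 <;> simp
      subst hxy
      obtain ⟨p, A, B, h1, h2, h3⟩ := ih U₀ W (by simpa using hU)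
        (hU'.infix ⟨[], [x], by simp⟩) (hW.infix ⟨[(x.1, !x.2)], [], by simp⟩)
      refine ⟨(x.1, !x.2) :: p, A, B, ?_, ?_, ?_⟩
      · rw [invRev_cons, ← List.append_assoc, ← h1]
        simp [invRev]
      · rw [h2]; rfl
      · rw [← h3]
        refine reduce.eq_of_red (Relation.ReflTransGen.single ?_)
        have := Red.Step.not (L₁ := U₀) (L₂ := W) (x := x.1) (b := x.2)
        simpa using this

/-- Shorten the conjugator from its end: a last letter z^{±1} commutes with z and can be dropped.
Once the last letter differs from z^{±1}, the word U z U⁻¹ is already reduced. -/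
theorem exists_toWord_of_isConj {z : α} {w : FreeGroup α} (h : IsConj (of z) w) :
    ∃ U, w.toWord = U ++ [(z, true)] ++ invRev U := by
  obtain ⟨c, rfl⟩ := isConj_iff.1 h
  suffices H : ∀ (n : ℕ) (U : List (α × Bool)), U.length = n → IsReduced U →
      ∃ U', (mk U * of z * (mk U)⁻¹).toWord = U' ++ [(z, true)] ++ invRev U' by
    obtain ⟨U', hU'⟩ := H _ c.toWord rfl isReduced_toWord
    exact ⟨U', by rw [← hU', mk_toWord]⟩
  intro n
  induction n with
  | zero =>
    intro U hU _
    obtain rfl := List.length_eq_zero_iff.1 hU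
    exact ⟨[], by simp [← one_eq_mk]⟩
  | succ n ih =>
    intro U hU hU'
    obtain ⟨U₀, x, rfl⟩ : ∃ U₀ x, U = U₀ ++ [x] := by
      rcases List.eq_nil_or_concat U with rfl | ⟨U₀, x, rfl⟩
      · simp at hU
      · exact ⟨U₀, x, by simp⟩
    by_cases hx : x.1 = z
    · obtain ⟨U', h'⟩ := ih U₀ (by simpa using hU) (hU'.infix ⟨[], [x], by simp⟩)
      refine ⟨U', ?_⟩
      rw [← h']
      congr 1
      have hc : Commute (mk [x]) (of z) := by
        rcases x with ⟨y, b⟩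
        obtain rfl : y = z := hx
        cases b
        · have : (mk [(y, false)] : FreeGroup α) = (of y)⁻¹ := by simp [of, invRev]
          rw [this]
          exact (Commute.refl _).inv_left
        · exact Commute.refl _
      rw [← mul_mk, mul_inv_rev, mul_assoc (mk U₀), hc.eq]
      group
    · refine ⟨U₀ ++ [x], ?_⟩
      have e : mk (U₀ ++ [x]) * of z * (mk (U₀ ++ [x]))⁻¹ =
          mk (U₀ ++ [x] ++ [(z, true)] ++ invRev (U₀ ++ [x])) := by
        simp [of, mul_mk]
      rw [e]
      refine toWord_mk_of_isReduced ?_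
      refine IsReduced.append_overlap (IsReduced.append_overlap hU' ?_ (by simp)) ?_ (by simp)
      · simp [isReduced_cons_cons, hx]
      · have hI : IsReduced (invRev (U₀ ++ [x])) := by
          rw [isReduced_iff_reduce_eq, reduce_invRev, hU'.reduce_eq]
        have e2 : invRev (U₀ ++ [x]) = (x.1, !x.2) :: invRev U₀ := by
          simp [invRev]
        rw [e2] at hI ⊢
        rw [List.singleton_append, isReduced_cons_cons]
        exact ⟨fun h => absurd h.symm hx, hI⟩

end words

/-! ### The weight: length, then codes of half-words -/

section weight

variable {α : Type*} [Fintype α]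

/-- The value of a word read as a numeral, the letters being the digits. -/
noncomputable def code (L : List (α × Bool)) : ℕ :=
  Nat.ofDigits (Fintype.card (α × Bool) + 2)
    (L.reverse.map fun s => (Fintype.equivFin (α × Bool) s : ℕ))

theorem code_append (A B : List (α × Bool)) :
    code (A ++ B) = code B + (Fintype.card (α × Bool) + 2) ^ B.length * code A := by
  simp [code, Nat.ofDigits_append]

theorem code_inj {A B : List (α × Bool)} (hl : A.length = B.length) (h : code A = code B) :
    A = B := by
  have := Nat.ofDigits_inj_of_len_eq (b := Fintype.card (α × Bool) + 2) (by omega)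
    (by simpa using hl) ?_ ?_ h
  · have hinj : Function.Injective fun s : α × Bool => (Fintype.equivFin (α × Bool) s : ℕ) :=
      Fin.val_injective.comp (Fintype.equivFin _).injective
    exact List.reverse_injective (hinj.list_map this)
  all_goals
    intro l hl
    obtain ⟨s, -, rfl⟩ := List.mem_map.1 hl
    have := (Fintype.equivFin (α × Bool) s).2
    omega

theorem code_append_lt {p q : List (α × Bool)} (h : code q < code p) (s : List (α × Bool)) :
    code (q ++ s) < code (p ++ s) := by
  rw [code_append, code_append]
  have : 0 < (Fintype.card (α × Bool) + 2) ^ s.length := by positivity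
  gcongr

variable [DecidableEq α]

/-- The sum of the codes of the initial halves of a reduced word and of its inverse. -/
noncomputable def halfCode (w : FreeGroup α) : ℕ :=
  code (w.toWord.take (FreeGroup.norm w / 2)) + code (w⁻¹.toWord.take (FreeGroup.norm w / 2))

/-- Length together with the codes of the two halves, ordered lexicographically. -/
noncomputable def weight (w : FreeGroup α) : ℕ ×ₗ ℕ := toLex (FreeGroup.norm w, halfCode w)

theorem weight_inv (w : FreeGroup α) : weight w⁻¹ = weight w := by
  simp [weight, halfCode, add_comm]

theorem weight_lt_of_norm_lt {v w : FreeGroup α} (h : FreeGroup.norm v < FreeGroup.norm w) : weight v < weight w :=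
  Prod.Lex.toLex_lt_toLex.2 (Or.inl h)

theorem weight_lt_of_halfCode_lt {v w : FreeGroup α} (h : FreeGroup.norm v ≤ FreeGroup.norm w)
    (h' : FreeGroup.norm v = FreeGroup.norm w → halfCode v < halfCode w) : weight v < weight w := by
  rcases h.lt_or_eq with h | h
  · exact weight_lt_of_norm_lt h
  · exact Prod.Lex.toLex_lt_toLex.2 (Or.inr ⟨h, h' h⟩)

/-- Either the new word is not reduced and the length drops, or the lengths agree. In the latter
case the prefix lies within the first half, so one half gets a smaller code, while the other half,
read from the inverse, is untouched. -/
theorem weight_replace_prefix_lt {w : FreeGroup α} {p q s : List (α × Bool)}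
    (hw : w.toWord = p ++ s) (hl : q.length = p.length) (h2 : 2 * p.length ≤ FreeGroup.norm w)
    (hc : code q < code p) : weight (mk (q ++ s)) < weight w := by
  have hn : FreeGroup.norm w = p.length + s.length := by rw [FreeGroup.norm, hw, List.length_append]
  have hle : FreeGroup.norm (mk (q ++ s)) ≤ FreeGroup.norm w := by
    refine norm_mk_le.trans ?_
    simp [hn, hl]
  refine weight_lt_of_halfCode_lt hle fun he => ?_
  have hw' : (mk (q ++ s)).toWord = q ++ s := by
    refine toWord_mk_of_length_le_norm ?_
    rw [he, hn]
    simp [hl]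
  rw [halfCode, halfCode, he, toWord_inv, toWord_inv, hw, hw', invRev_append, invRev_append]
  have t1 : ∀ r : List (α × Bool), r.length = p.length →
      (r ++ s).take (FreeGroup.norm w / 2) = r ++ s.take (FreeGroup.norm w / 2 - p.length) := by
    intro r hr
    rw [List.take_append, hr, List.take_of_length_le (by omega)]
  have t2 : ∀ r : List (α × Bool),
      (invRev s ++ invRev r).take (FreeGroup.norm w / 2) = (invRev s).take (FreeGroup.norm w / 2) := by
    intro r
    rw [List.take_append_of_le_length]
    rw [invRev_length]
    omega
  rw [t1 p rfl, t1 q hl, t2, t2]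
  exact Nat.add_lt_add_right (code_append_lt hc _) _

/-- In a word U x U⁻¹ both halves are U, so changing a prefix of U lowers both codes at once. This
is the tie-breaker for t₁, which may only be conjugated. -/
theorem weight_conj_replace_prefix_lt {w : FreeGroup α} {p q s : List (α × Bool)} {x : α × Bool}
    (hw : w.toWord = p ++ s ++ [x] ++ invRev (p ++ s)) (hl : q.length = p.length)
    (hc : code q < code p) :
    weight (mk (q ++ s ++ [x] ++ invRev (q ++ s))) < weight w := by
  have hn : FreeGroup.norm w = 2 * (p.length + s.length) + 1 := by
    rw [FreeGroup.norm, hw]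
    simp only [List.length_append, invRev_length, List.length_singleton]
    omega
  have hlen : (q ++ s ++ [x] ++ invRev (q ++ s)).length = FreeGroup.norm w := by
    rw [hn]
    simp only [List.length_append, invRev_length, List.length_singleton]
    omega
  refine weight_lt_of_halfCode_lt (norm_mk_le.trans hlen.le) fun he => ?_
  have hw' : (mk (q ++ s ++ [x] ++ invRev (q ++ s))).toWord = q ++ s ++ [x] ++ invRev (q ++ s) :=
    toWord_mk_of_length_le_norm (by rw [he, hlen])
  have hh : FreeGroup.norm w / 2 = p.length + s.length := by omega
  rw [halfCode, halfCode, he, toWord_inv, toWord_inv, hw, hw', hh]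
  have t1 : ∀ r : List (α × Bool), r.length = p.length →
      (r ++ s ++ [x] ++ invRev (r ++ s)).take (p.length + s.length) = r ++ s := by
    intro r hr
    rw [List.append_assoc, List.take_append_of_le_length (by simp [hr]),
      List.take_of_length_le (by simp [hr])]
  have t2 : ∀ r : List (α × Bool), r.length = p.length →
      (invRev (r ++ s ++ [x] ++ invRev (r ++ s))).take (p.length + s.length) = r ++ s := by
    intro r hr
    rw [invRev_append, invRev_invRev, List.take_append_of_le_length (by simp [hr]),
      List.take_of_length_le (by simp [hr])]
  rw [t1 p rfl, t1 q hl, t2 p rfl, t2 q hl]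
  exact Nat.add_lt_add (code_append_lt hc _) (code_append_lt hc _)

end weight

/-! ### Products without total cancellation -/

section products

variable {α : Type*} [DecidableEq α]

/-- In every three consecutive entries `a, b, d` of `L`, the middle one is not completely
cancelled in the product `a * b * d`. -/
def NoTotalCancellation (L : List (FreeGroup α)) : Prop :=
  ∀ L₁ a b d L₂, L = L₁ ++ a :: b :: d :: L₂ → FreeGroup.norm a + FreeGroup.norm d < FreeGroup.norm (a * b) + FreeGroup.norm (b * d)

/-- Here Y is the part of a cancelled by its left neighbour a₀, and Z is the part that survives in
h. The inequality says that the parts of a lost on its two sides do not exhaust it, so b eats into Z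
but not through it; the remainder Z₁ separates X from B and keeps the word reduced. -/
theorem toWord_mul_step {h a₀ a b : FreeGroup α} {X Y Z : List (α × Bool)}
    (hh : h.toWord = X ++ Z) (ha : a.toWord = Y ++ Z)
    (hY : 2 * Y.length + FreeGroup.norm (a₀ * a) = FreeGroup.norm a₀ + FreeGroup.norm a)
    (hab : FreeGroup.norm a₀ + FreeGroup.norm b < FreeGroup.norm (a₀ * a) + FreeGroup.norm (a * b)) :
    ∃ Z₁ p B, Z = Z₁ ++ invRev p ∧ Z₁ ≠ [] ∧ b.toWord = p ++ B ∧
      (h * b).toWord = X ++ Z₁ ++ B ∧ 2 * p.length + FreeGroup.norm (a * b) = FreeGroup.norm a + FreeGroup.norm b := by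
  obtain ⟨p, A, B, h1, h2, h3⟩ := exists_cancellation a b
  have e1 : FreeGroup.norm a = Y.length + Z.length := by rw [FreeGroup.norm, ha, List.length_append]
  have e2 : FreeGroup.norm a = A.length + p.length := by rw [FreeGroup.norm, h1, List.length_append, invRev_length]
  have e3 : FreeGroup.norm b = p.length + B.length := by rw [FreeGroup.norm, h2, List.length_append]
  have e4 : FreeGroup.norm (a * b) = A.length + B.length := by rw [FreeGroup.norm, h3, List.length_append]
  have hlt : Y.length < A.length := by omega
  have hA : Y ++ Z = A ++ invRev p := by rw [← ha, h1]
  obtain ⟨Z₁, hZ₁, hZ⟩ : ∃ Z₁, A = Y ++ Z₁ ∧ Z = Z₁ ++ invRev p := by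
    rcases List.append_eq_append_iff.1 hA with ⟨Z₁, h5, h6⟩ | ⟨Z₁, h5, h6⟩
    · exact ⟨Z₁, h5, h6⟩
    · have : Y.length = A.length + Z₁.length := by rw [h5, List.length_append]
      omega
  have hne : Z₁ ≠ [] := by
    rintro rfl
    simp [hZ₁] at hlt
  refine ⟨Z₁, p, B, hZ, hne, h2, ?_, by omega⟩
  have hred : IsReduced (X ++ Z₁ ++ B) := by
    refine IsReduced.append_overlap ?_ ?_ hne
    · have : IsReduced (X ++ Z) := hh ▸ isReduced_toWord
      exact this.infix ⟨[], invRev p, by simp [hZ]⟩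
    · have : IsReduced (A ++ B) := h3 ▸ isReduced_toWord
      exact this.infix ⟨Y, [], by simp [hZ₁]⟩
  rw [← toWord_mk_of_isReduced hred]
  congr 1
  rw [← mk_toWord (x := h), ← mk_toWord (x := b), hh, h2, hZ, ← mul_mk, ← mul_mk, ← mul_mk,
    ← mul_mk, ← mul_mk, ← inv_mk]
  group

/-- Each earlier factor leaves at least one letter, which gives the bound on X. The element a₀ is
the left neighbour of w, or 1 when w is the first factor; it records how much of w is cancelled on
the left. -/
theorem toWord_prod_left (A : List (FreeGroup α)) : ∀ (w : FreeGroup α),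
    NoTotalCancellation (1 :: A ++ [w]) →
    ∃ X Y Z, (A.prod * w).toWord = X ++ Z ∧ w.toWord = Y ++ Z ∧ A.length ≤ X.length ∧
      ∃ C a₀, 1 :: A = C ++ [a₀] ∧ 2 * Y.length + FreeGroup.norm (a₀ * w) = FreeGroup.norm a₀ + FreeGroup.norm w := by
  induction A using List.reverseRecOn with
  | nil => exact fun w _ => ⟨[], [], w.toWord, by simp, by simp, by simp, [], 1, by simp, by simp⟩
  | append_singleton A a ih =>
    intro w hw
    obtain ⟨X, Y, Z, h1, h2, h3, C, a₀, h4, h5⟩ := ih a (by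
      intro L₁ b c d L₂ h
      exact hw L₁ b c d (L₂ ++ [w]) (by
        rw [← List.cons_append, h]; simp))
    obtain ⟨Z₁, p, B, k1, k2, k3, k4, k5⟩ := toWord_mul_step (b := w) h1 h2 h5
      (hw C a₀ a w [] (by rw [← List.cons_append, h4]; simp))
    refine ⟨X ++ Z₁, p, B, by simpa using k4, k3, ?_, C ++ [a₀], a, ?_, k5⟩
    · have := List.length_pos_iff.2 k2
      simp only [List.length_append, List.length_singleton]
      omega
    · rw [← List.cons_append, h4]

theorem toWord_prod_right (B : List (FreeGroup α)) :
    ∀ (h a₀ a : FreeGroup α) (X Y Z : List (α × Bool)), h.toWord = X ++ Z → a.toWord = Y ++ Z →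
    2 * Y.length + FreeGroup.norm (a₀ * a) = FreeGroup.norm a₀ + FreeGroup.norm a →
    NoTotalCancellation (a₀ :: a :: B ++ [1]) →
    ∃ Z₁ p X', Z = Z₁ ++ invRev p ∧ Z₁ ≠ [] ∧ (h * B.prod).toWord = X ++ Z₁ ++ X' ∧
      B.length ≤ X'.length ∧
      ∃ d D, B ++ [1] = d :: D ∧ 2 * p.length + FreeGroup.norm (a * d) = FreeGroup.norm a + FreeGroup.norm d := by
  induction B with
  | nil =>
    intro h a₀ a X Y Z hh ha hY hB
    refine ⟨Z, [], [], by simp, ?_, by simpa using hh, by simp, 1, [], by simp, by simp⟩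
    have := hB [] a₀ a 1 [] (by simp)
    rintro rfl
    have e1 : FreeGroup.norm a = Y.length := by rw [FreeGroup.norm, ha]; simp
    simp only [FreeGroup.norm_one, mul_one] at this
    omega
  | cons b B ih =>
    intro h a₀ a X Y Z hh ha hY hB
    obtain ⟨Z₁, p, W, k1, k2, k3, k4, k5⟩ := toWord_mul_step (b := b) hh ha hY
      (hB [] a₀ a b (B ++ [1]) (by simp))
    obtain ⟨Z₂, p', X', m1, m2, m3, m4, -⟩ := ih (h * b) a b (X ++ Z₁) p W k4 k3 k5 (by
      intro L₁ u v d L₂ hL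
      exact hB (a₀ :: L₁) u v d L₂ (by
        rw [List.cons_append, List.cons_append, ← List.cons_append (as := b :: B), hL]; simp))
    refine ⟨Z₁, p, Z₂ ++ X', k1, k2, ?_, ?_, b, B ++ [1], by simp, k5⟩
    · rw [List.prod_cons, ← mul_assoc, m3]
      simp
    · have := List.length_pos_iff.2 m2
      simp only [List.length_append, List.length_cons]
      omega

/-- If no factor of a product is completely cancelled by its two neighbours, then the part of a
factor which survives is a subword of the reduced word of the product, and at least as many
letters precede and follow it as there are factors before and after. -/
theorem toWord_prod_of_noTotalCancellation (A B : List (FreeGroup α)) (w : FreeGroup α)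
    (h : NoTotalCancellation (1 :: A ++ w :: B ++ [1])) :
    ∃ X X' M p q, M ≠ [] ∧ w.toWord = p ++ M ++ invRev q ∧
      (A ++ w :: B).prod.toWord = X ++ M ++ X' ∧ A.length ≤ X.length ∧ B.length ≤ X'.length ∧
      (∃ C a₀, 1 :: A = C ++ [a₀] ∧ 2 * p.length + FreeGroup.norm (a₀ * w) = FreeGroup.norm a₀ + FreeGroup.norm w) ∧
      ∃ d D, B ++ [1] = d :: D ∧ 2 * q.length + FreeGroup.norm (w * d) = FreeGroup.norm w + FreeGroup.norm d := by
  obtain ⟨X, Y, Z, h1, h2, h3, C, a₀, h4, h5⟩ := toWord_prod_left A w (by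
    intro L₁ b c d L₂ hL
    exact h L₁ b c d (L₂ ++ (B ++ [1])) (by
      rw [← List.cons_append, ← List.cons_append] at *
      have : (1 : FreeGroup α) :: A ++ w :: B ++ [1] = (1 :: A ++ [w]) ++ (B ++ [1]) := by simp
      rw [this, hL]; simp))
  obtain ⟨M, q, X', k1, k2, k3, k4, k5⟩ := toWord_prod_right B (A.prod * w) a₀ w X Y Z h1 h2 h5 (by
    intro L₁ b c d L₂ hL
    exact h (C ++ L₁) b c d L₂ (by
      rw [h4, List.append_assoc C L₁, ← hL]; simp))
  refine ⟨X, X', M, Y, q, k2, ?_, ?_, h3, k4, ⟨C, a₀, h4, h5⟩, k5⟩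
  · rw [h2, k1]; simp
  · rw [← k3]; simp [mul_assoc]

end products

end cancellationInWords

open FreeGroup (of mk invRev one_eq_mk mul_mk inv_mk)

/-! ### Letters, inverse letters and homomorphisms on words -/

section letters

variable {α : Type*}

/-- The inverse of a letter. -/
def neg (s : α × Bool) : α × Bool := (s.1, !s.2)

@[simp] theorem neg_fst (s : α × Bool) : (neg s).1 = s.1 := rfl

@[simp] theorem neg_neg_letter (s : α × Bool) : neg (neg s) = s := by simp [neg]

theorem neg_ne_self (s : α × Bool) : neg s ≠ s := fun h => by
  have := congrArg Prod.snd h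
  simp [neg] at this

theorem eq_or_eq_neg {s l : α × Bool} (h : s.1 = l.1) : s = l ∨ s = neg l := by
  rcases s with ⟨y, b⟩
  rcases l with ⟨z, c⟩
  obtain rfl : y = z := h
  cases b <;> cases c <;> simp [neg]

theorem mk_cons (s : α × Bool) (L : List (α × Bool)) : mk (s :: L) = mk [s] * mk L := by
  rw [mul_mk, List.singleton_append]

theorem mk_append (L M : List (α × Bool)) : mk (L ++ M) = mk L * mk M := mul_mk.symm

theorem mk_neg (s : α × Bool) : mk [neg s] = (mk [s])⁻¹ := by
  simp [neg, invRev]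

theorem mk_true (z : α) : mk [(z, true)] = of z := rfl

theorem mk_false (z : α) : mk [(z, false)] = (of z)⁻¹ := by
  rw [← mk_true, ← mk_neg]; rfl

theorem mk_letter (s : α × Bool) : mk [s] = of s.1 ∨ mk [s] = (of s.1)⁻¹ := by
  rcases s with ⟨z, _ | _⟩
  · exact Or.inr (mk_false z)
  · exact Or.inl (mk_true z)

theorem hom_mk_congr {G : Type*} [Group G] {φ ψ : FreeGroup α →* G} {L : List (α × Bool)}
    (h : ∀ s ∈ L, φ (of s.1) = ψ (of s.1)) : φ (mk L) = ψ (mk L) := by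
  induction L with
  | nil => rw [← one_eq_mk, map_one, map_one]
  | cons s L ih =>
    rw [mk_cons, map_mul, map_mul, ih fun r hr => h r (List.mem_cons_of_mem _ hr)]
    have := h s List.mem_cons_self
    rcases mk_letter s with e | e <;> rw [e]
    · rw [this]
    · rw [map_inv, map_inv, this]

theorem aut_mk_congr {φ ψ : MulAut (FreeGroup α)} {L : List (α × Bool)}
    (h : ∀ s ∈ L, φ (of s.1) = ψ (of s.1)) : φ (mk L) = ψ (mk L) :=
  hom_mk_congr (φ := φ.toMonoidHom) (ψ := ψ.toMonoidHom) h

theorem aut_mk_eq_self {φ : MulAut (FreeGroup α)} {L : List (α × Bool)}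
    (h : ∀ s ∈ L, φ (of s.1) = of s.1) : φ (mk L) = mk L :=
  aut_mk_congr (ψ := 1) h

theorem commute_hom_mk {G : Type*} [Group G] (χ : FreeGroup α →* G) {g : G}
    {L : List (α × Bool)} (h : ∀ s ∈ L, Commute g (χ (mk [s]))) : Commute g (χ (mk L)) := by
  induction L with
  | nil => rw [← one_eq_mk, map_one]; exact Commute.one_right g
  | cons s L ih =>
    rw [mk_cons, map_mul]
    exact (h s List.mem_cons_self).mul_right (ih fun r hr => h r (List.mem_cons_of_mem _ hr))

/-- A word closed under inversion of letters is mapped to `1` by a homomorphism with commuting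
values on its letters. -/
theorem hom_mk_eq_one {G : Type*} [Group G] (χ : FreeGroup α →* G) (n : ℕ) :
    ∀ L : List (α × Bool), L.length ≤ n → L.Nodup →
    (∀ s ∈ L, χ (mk [s]) = 1 ∨ neg s ∈ L) →
    (∀ s ∈ L, ∀ r ∈ L, Commute (χ (mk [s])) (χ (mk [r]))) → χ (mk L) = 1 := by
  induction n with
  | zero =>
    intro L hL _ _ _
    obtain rfl := List.length_eq_zero_iff.1 (Nat.le_zero.1 hL)
    rw [← one_eq_mk, map_one]
  | succ n ih =>
    intro L hL hnd hcl hc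
    rcases L with _ | ⟨s, L⟩
    · rw [← one_eq_mk, map_one]
    · have hs : s ∉ L := (List.nodup_cons.1 hnd).1
      rw [mk_cons, map_mul]
      by_cases h1 : χ (mk [s]) = 1
      · rw [h1, one_mul]
        refine ih L (by simpa using hL) (List.nodup_cons.1 hnd).2 (fun r hr => ?_)
          fun r hr r' hr' => hc r (List.mem_cons_of_mem _ hr) r' (List.mem_cons_of_mem _ hr')
        rcases hcl r (List.mem_cons_of_mem _ hr) with h | h
        · exact Or.inl h
        · rcases List.mem_cons.1 h with h | h
          · left
            rw [← inv_eq_one, ← map_inv, ← mk_neg, h, h1]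
          · exact Or.inr h
      · have hm : neg s ∈ L := by
          rcases hcl s List.mem_cons_self with h | h
          · exact absurd h h1
          · exact (List.mem_cons.1 h).resolve_left (neg_ne_self s)
        obtain ⟨A, B, rfl⟩ := List.append_of_mem hm
        have hcA : Commute (χ (mk [s])) (χ (mk A)) :=
          commute_hom_mk χ fun r hr => hc s List.mem_cons_self r (by simp [hr])
        have hAB : χ (mk (A ++ B)) = 1 := by
          refine ih (A ++ B) ?_ ?_ (fun r hr => ?_) fun r hr r' hr' => hc r ?_ r' ?_
          · simp at hL ⊢; omega
          · exact ((List.perm_middle.nodup_iff).1 (List.nodup_cons.1 hnd).2).of_cons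
          · have hr' : r ∈ A ++ neg s :: B := by
              simp only [List.mem_append, List.mem_cons] at hr ⊢; tauto
            refine (hcl r (List.mem_cons_of_mem _ hr')).imp_right fun h => ?_
            have hnot : neg s ∉ A ++ B :=
              (List.nodup_cons.1 ((List.perm_middle.nodup_iff).1 (List.nodup_cons.1 hnd).2)).1
            simp only [List.mem_cons, List.mem_append] at h ⊢
            rcases h with h | h | h | h
            · rw [← h, neg_neg_letter] at hnot
              exact absurd hr hnot
            · exact Or.inl h
            · have : r = s := by rw [← neg_neg_letter r, h, neg_neg_letter]
              exact absurd (this ▸ hr') hs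
            · exact Or.inr h
          · simp only [List.mem_append, List.mem_cons] at hr ⊢; tauto
          · simp only [List.mem_append, List.mem_cons] at hr' ⊢; tauto
        rw [mk_append, mk_cons (neg s), map_mul, map_mul, mk_neg, map_inv, ← mul_assoc, hcA.eq, ← hAB,
          mk_append, map_mul]
        group

end letters

/-! ### Elementary automorphisms of a free group -/

section automorphisms

variable {α : Type*}

theorem exists_transvection_aux (z : α) (u v : List (α × Bool)) (hu : ∀ s ∈ u, s.1 ≠ z)
    (hv : ∀ s ∈ v, s.1 ≠ z) : ∃ E : MulAut (FreeGroup α),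
      E (of z) = mk u * of z * mk v ∧ ∀ y ≠ z, E (of y) = of y := by
  classical
  let f (a b : FreeGroup α) : FreeGroup α →* FreeGroup α :=
    FreeGroup.lift fun y => if y = z then a * of z * b else of y
  have fz (a b) : f a b (of z) = a * of z * b := by simp [f]
  have fy (a b) (y) (hy : y ≠ z) : f a b (of y) = of y := by simp [f, hy]
  have ffix (a b) (L : List (α × Bool)) (hL : ∀ s ∈ L, s.1 ≠ z) : f a b (mk L) = mk L :=
    hom_mk_congr (ψ := MonoidHom.id _) fun s hs => fy a b _ (hL s hs)
  have hcomp (a b) (hau : ∀ c d, f c d a = a) (hbv : ∀ c d, f c d b = b) :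
      (f a⁻¹ b⁻¹).comp (f a b) = MonoidHom.id _ := by
    refine FreeGroup.ext_hom _ _ fun y => ?_
    by_cases hy : y = z
    · subst hy
      rw [MonoidHom.comp_apply, fz, map_mul, map_mul, hau, hbv, fz, MonoidHom.id_apply]
      group
    · rw [MonoidHom.comp_apply, fy _ _ _ hy, fy _ _ _ hy, MonoidHom.id_apply]
  have h1 := hcomp (mk u) (mk v) (fun c d => ffix c d u hu) fun c d => ffix c d v hv
  have h2 := hcomp (mk u)⁻¹ (mk v)⁻¹ (fun c d => by rw [map_inv, ffix c d u hu])
    fun c d => by rw [map_inv, ffix c d v hv]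
  rw [inv_inv, inv_inv] at h2
  exact ⟨(f (mk u) (mk v)).toMulEquiv (f (mk u)⁻¹ (mk v)⁻¹) h1 h2, fz _ _, fun y hy => fy _ _ y hy⟩

/-- The automorphism which multiplies a letter by words not involving it. -/
theorem exists_transvection (l : α × Bool) (u v : List (α × Bool)) (hu : ∀ s ∈ u, s.1 ≠ l.1)
    (hv : ∀ s ∈ v, s.1 ≠ l.1) : ∃ E : MulAut (FreeGroup α),
      E (mk [l]) = mk u * mk [l] * mk v ∧ ∀ y ≠ l.1, E (of y) = of y := by
  rcases l with ⟨z, _ | _⟩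
  · have hinv : ∀ w : List (α × Bool), (∀ s ∈ w, s.1 ≠ z) → ∀ s ∈ invRev w, s.1 ≠ z := by
      intro w hw s hs
      simp only [invRev, List.mem_reverse, List.mem_map] at hs
      obtain ⟨r, hr, rfl⟩ := hs
      exact hw r hr
    obtain ⟨E, h1, h2⟩ := exists_transvection_aux z (invRev v) (invRev u) (hinv v hv) (hinv u hu)
    refine ⟨E, ?_, h2⟩
    rw [mk_false, map_inv, h1, ← inv_mk, ← inv_mk]
    group
  · exact exists_transvection_aux z u v hu hv

/-- The automorphism which interchanges the letters `a` and `x`, and their inverses. -/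
theorem exists_relabelling (a x : α × Bool) : ∃ (σ : α × Bool → α × Bool) (ρ : MulAut (FreeGroup α)),
    Function.Involutive σ ∧ σ a = x ∧ (∀ s, σ (neg s) = neg (σ s)) ∧
    (∀ s, s.1 ≠ a.1 → s.1 ≠ x.1 → σ s = s) ∧ ∀ L, ρ (mk (L.map σ)) = mk L := by
  classical
  let σ : α × Bool → α × Bool := fun s =>
    if s.1 = a.1 then (x.1, xor s.2 (xor a.2 x.2))
    else if s.1 = x.1 then (a.1, xor s.2 (xor a.2 x.2)) else s
  have hσ : Function.Involutive σ := by
    rintro ⟨z, b⟩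
    by_cases h1 : z = a.1 <;> by_cases h2 : z = x.1 <;> by_cases h3 : x.1 = a.1 <;>
      simp_all [σ]
  have hneg : ∀ s, σ (neg s) = neg (σ s) := by
    rintro ⟨z, b⟩
    by_cases h1 : z = a.1 <;> by_cases h2 : z = x.1 <;> simp_all [σ, neg]
  let r : FreeGroup α →* FreeGroup α := FreeGroup.lift fun y => mk [σ (y, true)]
  have hr1 : ∀ s, r (mk [s]) = mk [σ s] := by
    rintro ⟨y, _ | _⟩
    · have e : (y, false) = neg (y, true) := rfl
      rw [e, mk_neg, map_inv, hneg, mk_neg]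
      congr 1
    · exact FreeGroup.lift_apply_of
  have hr : ∀ L, r (mk L) = mk (L.map σ) := by
    intro L
    induction L with
    | nil => rw [← one_eq_mk, map_one]; rfl
    | cons s L ih => rw [mk_cons, map_mul, hr1, ih, List.map_cons, ← mk_cons]
  have hrr : r.comp r = MonoidHom.id _ := by
    refine MonoidHom.ext fun w => ?_
    rw [MonoidHom.comp_apply]
    obtain ⟨L, rfl⟩ : ∃ L, mk L = w := Quot.exists_rep w
    rw [hr, hr, List.map_map, hσ.comp_self, List.map_id, MonoidHom.id_apply]
  refine ⟨σ, r.toMulEquiv r hrr hrr, hσ, ?_, hneg, ?_, ?_⟩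
  · simp [σ]
  · intro s h1 h2
    simp [σ, h1, h2]
  · intro L
    change r (mk (L.map σ)) = mk L
    rw [hr, List.map_map, hσ.comp_self, List.map_id]

end automorphisms

/-! ### Markings and linked letters -/

section markings

variable {g : ℕ}

noncomputable instance {g p : ℕ} : DecidableEq (Gen g p) := Classical.decEq _

noncomputable instance {g p : ℕ} : Fintype (Gen g p) :=
  Fintype.ofInjective
    (fun s : Gen g p => match s with
      | .t j => (Sum.inl j : Fin p ⊕ Fin g ⊕ Fin g)
      | .x i => Sum.inr (Sum.inl i)
      | .y i => Sum.inr (Sum.inr i))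
    (by rintro (a | a | a) (b | b | b) h <;> simp_all)

/-- The letters of words in the basis of `F_{g,1}`. -/
abbrev Letter (g : ℕ) : Type := Gen g 1 × Bool

/-- The letter `t_1`. -/
def tL : Letter g := (Gen.t 0, true)

theorem mk_tL : mk [(tL : Letter g)] = tt 0 := rfl

/-- The pair of an automorphism `β` and a word `V`, in which `t_1` and every letter other than
`t_1⁻¹` occurs exactly once, such that `β` maps `V` to `V₀` and preserves the class of `t_1`. -/
structure IsMarking (β : MulAut (F g 1)) (V : List (Letter g)) : Prop where
  intro ::
  nodup : V.Nodup
  mem : ∀ s, s ∈ V ↔ s ≠ neg tL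
  conj : IsConj (tt 0) (β (tt 0))
  map : β (mk V) = V₀ g 1

theorem IsMarking.eq_tL {β : MulAut (F g 1)} {V : List (Letter g)} (h : IsMarking β V)
    {s : Letter g} (hs : s ∈ V) (h1 : s.1 = Gen.t 0) : s = tL := by
  rcases eq_or_eq_neg (l := tL) h1 with e | e
  · exact e
  · exact absurd e ((h.mem s).1 hs)

theorem IsMarking.mem_of_ne {β : MulAut (F g 1)} {V : List (Letter g)} (h : IsMarking β V)
    {s : Letter g} (h1 : s.1 ≠ Gen.t 0) : s ∈ V :=
  (h.mem s).2 fun e => h1 (by rw [e]; rfl)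

theorem prod_ofFn_eq_of_forall_ne {G : Type*} [Group G] : ∀ {n : ℕ} (f : Fin n → G) (i : Fin n),
    (∀ j, j ≠ i → f j = 1) → (List.ofFn f).prod = f i := by
  intro n
  induction n with
  | zero => exact fun f i => i.elim0
  | succ n ih =>
    intro f i h
    rw [List.ofFn_succ, List.prod_cons]
    induction i using Fin.cases with
    | zero =>
      have : (List.ofFn fun i : Fin n => f i.succ).prod = 1 := by
        refine List.prod_eq_one fun x hx => ?_
        obtain ⟨j, rfl⟩ := (List.mem_ofFn' _ _).1 hx
        exact h _ (Fin.succ_ne_zero j)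
      rw [this, mul_one]
    | succ i =>
      rw [h 0 (Fin.succ_ne_zero i).symm, one_mul]
      exact ih (fun i => f i.succ) i fun j hj => h _ fun e => hj (Fin.succ_injective _ e)

theorem V₀_one (g : ℕ) : V₀ g 1 =
    tt 0 * (List.ofFn fun i : Fin g => comm (xx i : F g 1) (yy i)).prod := by
  simp [V₀]

theorem perm_three_comm : ∀ a b : Equiv.Perm (Fin 3), Equiv.Perm.sign a = 1 →
    Equiv.Perm.sign b = 1 → Commute a b := by
  have : ∀ a b : Equiv.Perm (Fin 3), Equiv.Perm.sign a = 1 →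
    Equiv.Perm.sign b = 1 → a * b = b * a := by decide
  exact this

/-- In the word of a marking every letter is linked with another one. -/
theorem IsMarking.exists_linked {β : MulAut (F g 1)} {V : List (Letter g)} (h : IsMarking β V)
    {P Q S : List (Letter g)} {a : Letter g} (hV : V = P ++ a :: Q ++ neg a :: S)
    (ha : a.1 ≠ Gen.t 0) : ∃ b ∈ Q, b.1 ≠ Gen.t 0 ∧ neg b ∉ Q := by
  by_contra! hQ
  -- If a is linked with no letter, a homomorphism to S₃ is constructed that is trivial on β(V) but
  -- not on V₀. Its sign α, read through β, is -1 exactly on the basis element underlying a.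
  let α : F g 1 →* ℤˣ :=
    (FreeGroup.lift fun y => if y = a.1 then (-1 : ℤˣ) else 1).comp β.symm.toMonoidHom
  have hα : ∀ y, α (β (of y)) = if y = a.1 then -1 else 1 := by
    intro y
    have : β.symm (β (of y)) = of y := β.symm_apply_apply _
    simp only [α, MonoidHom.comp_apply, MulEquiv.toMonoidHom_eq_coe, MonoidHom.coe_coe, this,
      FreeGroup.lift_apply_of]
  have hαt : α (tt 0) = 1 := by
    have h1 : IsConj (α (tt 0)) (α (β (tt 0))) := α.map_isConj h.conj
    rw [isConj_iff_eq] at h1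
    rw [h1, tt, hα, if_neg ha.symm]
  have hex : ∃ i : Fin g, α (xx i) ≠ 1 ∨ α (yy i) ≠ 1 := by
    by_contra! hno
    have h1 : α = 1 := by
      refine FreeGroup.ext_hom _ _ fun y => ?_
      rcases y with j | i | i
      · obtain rfl := Subsingleton.elim j 0
        exact hαt
      · exact (hno i).1
      · exact (hno i).2
    have h2 := hα a.1
    rw [if_pos rfl, h1] at h2
    have h3 : (1 : ℤˣ) = -1 := h2
    exact absurd h3 (by decide)
  obtain ⟨i, hi⟩ := hex
  let r : Equiv.Perm (Fin 3) := Equiv.swap 0 1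
  let c : Equiv.Perm (Fin 3) := finRotate 3
  obtain ⟨y₀, hy₀t, hy₀i, hy₀⟩ : ∃ y₀ : Gen g 1, y₀ ≠ Gen.t 0 ∧
      (∀ j, j ≠ i → y₀ ≠ Gen.x j ∧ y₀ ≠ Gen.y j) ∧
      ((y₀ = Gen.y i ∧ α (xx i) ≠ 1) ∨ (y₀ = Gen.x i ∧ α (yy i) ≠ 1)) := by
    rcases hi with hi | hi
    · exact ⟨Gen.y i, by simp, fun j hj => by simp [hj.symm], Or.inl ⟨rfl, hi⟩⟩
    · exact ⟨Gen.x i, by simp, fun j hj => by simp [hj.symm], Or.inr ⟨rfl, hi⟩⟩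
  -- The basis elements with α = -1 go to a fixed transposition, and y₀, the partner of an element
  -- of handle i with α ≠ 1, is further multiplied by a 3-cycle. The commutator of handle i then
  -- survives, while all others have commuting entries.
  let Φ : F g 1 →* Equiv.Perm (Fin 3) :=
    FreeGroup.lift fun y => (if α (of y) = 1 then 1 else r) * (if y = y₀ then c else 1)
  have hΦ : ∀ y, Φ (of y) = (if α (of y) = 1 then 1 else r) * (if y = y₀ then c else 1) :=
    fun y => FreeGroup.lift_apply_of
  have hsign : ∀ w, Equiv.Perm.sign (Φ w) = α w := by
    have : (Equiv.Perm.sign).comp Φ = α := by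
      refine FreeGroup.ext_hom _ _ fun y => ?_
      rw [MonoidHom.comp_apply, hΦ, map_mul]
      have hr : Equiv.Perm.sign r = -1 := by decide
      have hc : Equiv.Perm.sign c = 1 := by decide
      generalize α (of y) = u
      rcases Int.units_eq_one_or u with rfl | rfl <;> by_cases hy : y = y₀ <;> simp [hy, hr, hc]
    exact fun w => DFunLike.congr_fun this w
  have hΦt : Φ (tt 0) = 1 := by
    rw [tt, hΦ, if_neg hy₀t.symm]
    rw [tt] at hαt
    rw [if_pos hαt, mul_one]
  have hΦV : Φ (V₀ g 1) ≠ 1 := by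
    have e : Φ (V₀ g 1) = comm (Φ (xx i)) (Φ (yy i)) := by
      rw [V₀_one, map_mul, hΦt, one_mul, map_list_prod, List.map_ofFn,
        prod_ofFn_eq_of_forall_ne _ i]
      · simp [comm]
      · intro j hj
        have h1 := (hy₀i j hj).1
        have h2 := (hy₀i j hj).2
        simp only [Function.comp, comm, map_mul, map_inv, xx, yy, hΦ, if_neg h1.symm, if_neg h2.symm]
        split_ifs <;> simp
    rw [e]
    have hxy : (Gen.x i : Gen g 1) ≠ Gen.y i := by simp
    rcases hy₀ with ⟨rfl, hi'⟩ | ⟨rfl, hi'⟩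
    · rw [xx] at hi'
      rw [xx, yy, hΦ, hΦ, if_neg hi', if_neg hxy, if_pos rfl]
      split_ifs <;> decide
    · rw [yy] at hi'
      rw [xx, yy, hΦ, hΦ, if_neg hi', if_pos rfl, if_neg hxy.symm]
      split_ifs <;> decide
  refine hΦV ?_
  let χ : F g 1 →* Equiv.Perm (Fin 3) := Φ.comp β.toMonoidHom
  have hχ : ∀ w, χ w = Φ (β w) := fun w => rfl
  have hχt : χ (tt 0) = 1 := by
    have h1 : IsConj (Φ (tt 0)) (Φ (β (tt 0))) := Φ.map_isConj h.conj
    rw [hΦt] at h1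
    rw [hχ]
    exact isConj_one_right.1 h1
  have hχs : ∀ s : Letter g, s.1 ≠ a.1 → Equiv.Perm.sign (χ (mk [s])) = 1 := by
    intro s hs
    rw [hχ, hsign]
    rcases mk_letter s with e | e <;> rw [e]
    · rw [hα, if_neg hs]
    · rw [map_inv, map_inv, hα, if_neg hs, inv_one]
  have hnd := h.nodup
  rw [hV] at hnd
  -- Letters other than a^{±1} have even, hence commuting, values. A word in them closed under
  -- inversion, apart from t₁ which maps to 1, is therefore killed. This applies to Q and to P S, so
  -- a Q a⁻¹ collapses and β(V) maps to 1.
  have hone : ∀ L : List (Letter g), L.Nodup → (∀ s ∈ L, s.1 ≠ a.1) →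
      (∀ s ∈ L, s.1 ≠ Gen.t 0 → neg s ∈ L) → (∀ s ∈ L, s ∈ V) → χ (mk L) = 1 := by
    intro L h1 h2 h3 h4
    refine hom_mk_eq_one χ _ L le_rfl h1 (fun s hs => ?_) fun s hs r hr =>
      perm_three_comm _ _ (hχs s (h2 s hs)) (hχs r (h2 r hr))
    by_cases hst : s.1 = Gen.t 0
    · left
      rw [h.eq_tL (h4 s hs) hst]
      exact hχt
    · exact Or.inr (h3 s hs hst)
  have hmemV : ∀ s, s ∈ V ↔ (s ∈ P ∨ s = a ∨ s ∈ Q ∨ s = neg a ∨ s ∈ S) := by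
    intro s
    simp [hV]
  have hperm : (P ++ a :: Q ++ neg a :: S).Perm (a :: neg a :: (Q ++ (P ++ S))) := by
    rw [List.perm_iff_count]
    intro s
    simp only [List.count_append, List.count_cons]
    omega
  have hnd' := hperm.nodup_iff.1 hnd
  simp only [List.nodup_cons, List.mem_cons, List.mem_append, not_or] at hnd'
  obtain ⟨⟨-, ha1, ha2, ha3⟩, ⟨ha4, ha5, ha6⟩, hnd2⟩ := hnd'
  have hQ1 : χ (mk Q) = 1 := by
    refine hone Q hnd2.of_append_left (fun s hs e => ?_) hQ fun s hs => (hmemV s).2 (by tauto)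
    rcases eq_or_eq_neg e with rfl | rfl
    · exact ha1 hs
    · exact ha4 hs
  have hPS : χ (mk (P ++ S)) = 1 := by
    refine hone (P ++ S) hnd2.of_append_right (fun s hs e => ?_) (fun s hs hst => ?_)
      fun s hs => (hmemV s).2 (by simp only [List.mem_append] at hs; tauto)
    · simp only [List.mem_append] at hs
      rcases eq_or_eq_neg e with rfl | rfl <;> tauto
    · have hm : neg s ∈ V := h.mem_of_ne (by simpa using hst)
      simp only [List.mem_append] at hs ⊢
      rcases (hmemV _).1 hm with h1 | h1 | h1 | h1 | h1
      · exact Or.inl h1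
      · have : s = neg a := by rw [← h1, neg_neg_letter]
        subst this
        tauto
      · have h2 := hQ _ h1 (by simpa using hst)
        rw [neg_neg_letter] at h2
        exact absurd (List.mem_append.2 hs) fun h3 => (List.disjoint_of_nodup_append hnd2) h2 h3
      · have : s = a := by rw [← neg_neg_letter s, h1, neg_neg_letter]
        subst this
        tauto
      · exact Or.inr h1
  rw [← h.map, ← hχ, hV, mk_append, mk_append, mk_cons, mk_cons (neg a), mk_neg, map_mul, map_mul,
    map_mul, map_mul, hQ1, mul_one, map_inv, mul_assoc, mul_inv_cancel_left, ← map_mul, ← mk_append, hPS]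

/-- Adjacent mutually inverse letters would enclose an empty word, which cannot contain a linked
letter. -/
theorem IsMarking.fst_ne_of_adjacent {β : MulAut (F g 1)} {V : List (Letter g)}
    (h : IsMarking β V) {P Q : List (Letter g)} {l m : Letter g} (hV : V = P ++ l :: m :: Q) :
    l.1 ≠ m.1 := by
  intro e
  have hnd := h.nodup
  rw [hV] at hnd
  have hlm : l ≠ m := by
    have := (List.nodup_cons.1 hnd.of_append_right).1
    simp only [List.mem_cons, not_or] at this
    exact this.1
  have hl : l ∈ V := by simp [hV]
  have hm : m ∈ V := by simp [hV]
  by_cases hlt : l.1 = Gen.t 0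
  · exact hlm ((h.eq_tL hl hlt).trans (h.eq_tL hm (e ▸ hlt)).symm)
  · rcases eq_or_eq_neg e.symm with rfl | rfl
    · exact hlm rfl
    · obtain ⟨b, hb, -⟩ := h.exists_linked (P := P) (Q := []) (S := Q) (a := l) (by simp [hV]) hlt
      simp at hb

end markings

theorem mk_cons_true {α : Type*} (z : α) (L : List (α × Bool)) :
    mk ((z, true) :: L) = of z * mk L := by rw [mk_cons, mk_true]

theorem mk_cons_false {α : Type*} (z : α) (L : List (α × Bool)) :
    mk ((z, false) :: L) = (of z)⁻¹ * mk L := by rw [mk_cons, mk_false]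

/-! ### Cutting and pasting to the normal form of a surface -/

section normalForm

variable {g : ℕ}

/-- The word `[x_1, y_1] ⋯ [x_k, y_k]`. -/
def commWord (g : ℕ) : ℕ → List (Letter g)
  | 0 => []
  | k + 1 => commWord g k ++ if h : k < g then
      [(Gen.x ⟨k, h⟩, false), (Gen.y ⟨k, h⟩, false), (Gen.x ⟨k, h⟩, true), (Gen.y ⟨k, h⟩, true)]
      else []

theorem commWord_succ {k : ℕ} (h : k < g) : commWord g (k + 1) = commWord g k ++
    [(Gen.x ⟨k, h⟩, false), (Gen.y ⟨k, h⟩, false), (Gen.x ⟨k, h⟩, true), (Gen.y ⟨k, h⟩, true)] := by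
  rw [commWord, dif_pos h]

theorem mem_commWord {k : ℕ} {s : Letter g} :
    s ∈ commWord g k ↔ ∃ i : Fin g, i.val < k ∧ (s.1 = Gen.x i ∨ s.1 = Gen.y i) := by
  induction k with
  | zero => simp [commWord]
  | succ k ih =>
    rw [commWord, List.mem_append, ih]
    constructor
    · rintro (⟨i, hi, h⟩ | h)
      · exact ⟨i, by omega, h⟩
      · split_ifs at h with hk
        · refine ⟨⟨k, hk⟩, by simp, ?_⟩
          simp only [List.mem_cons, List.not_mem_nil, or_false] at h
          rcases h with rfl | rfl | rfl | rfl <;> simp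
        · simp at h
    · rintro ⟨i, hi, h⟩
      rcases Nat.lt_succ_iff_lt_or_eq.1 hi with hi | hi
      · exact Or.inl ⟨i, hi, h⟩
      · right
        subst hi
        rw [dif_pos i.2]
        rcases s with ⟨z, _ | _⟩ <;> rcases h with h | h <;> simp only at h <;> subst h <;> simp

theorem tL_notMem_commWord (k : ℕ) : (tL : Letter g) ∉ commWord g k := by
  rw [mem_commWord]
  rintro ⟨i, -, h | h⟩ <;> simp [tL] at h

theorem nodup_commWord {k : ℕ} (hk : k ≤ g) : (tL :: commWord g k).Nodup := by
  refine List.nodup_cons.2 ⟨tL_notMem_commWord k, ?_⟩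
  induction k with
  | zero => simp [commWord]
  | succ k ih =>
    rw [commWord_succ hk, List.nodup_append']
    refine ⟨ih (by omega), by simp, fun s hs h => ?_⟩
    obtain ⟨i, hi, h'⟩ := mem_commWord.1 hs
    simp only [List.mem_cons, List.not_mem_nil, or_false] at h
    rcases h with rfl | rfl | rfl | rfl <;> rcases h' with h' | h' <;>
      simp only [Gen.x.injEq, Gen.y.injEq, reduceCtorEq] at h' <;> simp [← h'] at hi

theorem mk_commWord {k : ℕ} (hk : k ≤ g) : mk (commWord g k) =
    ((List.ofFn fun i : Fin g => comm (xx i : F g 1) (yy i)).take k).prod := by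
  induction k with
  | zero => simp [commWord, ← one_eq_mk]
  | succ k ih =>
    rw [commWord_succ hk, mk_append, ih (by omega), List.prod_take_succ _ _ (by simpa using hk),
      List.getElem_ofFn]
    congr 1

theorem mk_cons_commWord (g : ℕ) : mk (tL :: commWord g g) = V₀ g 1 := by
  rw [mk_cons, mk_tL, mk_commWord le_rfl, V₀_one, List.take_of_length_le (by simp)]

theorem mem_A_iff {φ : MulAut (F g 1)} :
    φ ∈ A g 1 ↔ φ (V₀ g 1) = V₀ g 1 ∧ IsConj (tt 0) (φ (tt 0)) := by
  have h1 : tClasses g 1 = {ConjClasses.mk (tt 0)} := by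
    rw [tClasses, Set.range_unique]
    rfl
  change (_ ∧ _ = tClasses g 1) ↔ _
  rw [h1, Set.image_singleton, Set.singleton_eq_singleton_iff]
  refine and_congr_right fun _ => ?_
  rw [isConj_comm, ← ConjClasses.mk_eq_mk_iff_isConj]
  exact Iff.rfl

theorem isMarking_commWord {φ : MulAut (F g 1)} (h : φ ∈ A g 1) :
    IsMarking φ (tL :: commWord g g) where
  nodup := nodup_commWord le_rfl
  mem s := by
    constructor
    · rintro hs rfl
      rcases List.mem_cons.1 hs with h | h
      · exact neg_ne_self _ h
      · obtain ⟨i, -, h | h⟩ := mem_commWord.1 h <;> simp [tL] at h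
    · intro hs
      rcases hs1 : s.1 with j | i | i
      · rw [Subsingleton.elim j 0] at hs1
        rcases eq_or_eq_neg (l := tL) hs1 with rfl | rfl
        · exact List.mem_cons_self
        · exact absurd rfl hs
      · exact List.mem_cons_of_mem _ (mem_commWord.2 ⟨i, i.2, Or.inl hs1⟩)
      · exact List.mem_cons_of_mem _ (mem_commWord.2 ⟨i, i.2, Or.inr hs1⟩)
  conj := (mem_A_iff.1 h).2
  map := by rw [mk_cons_commWord, (mem_A_iff.1 h).1]

theorem IsMarking.of_perm {β β' : MulAut (F g 1)} {V V' : List (Letter g)} (h : IsMarking β V)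
    (hV : V'.Perm V) (hconj : IsConj (tt 0) (β' (tt 0))) (hmap : β' (mk V') = β (mk V)) :
    IsMarking β' V' where
  nodup := hV.nodup_iff.2 h.nodup
  mem s := by rw [hV.mem_iff, h.mem]
  conj := hconj
  map := by rw [hmap, h.map]

theorem IsMarking.relabel {β : MulAut (F g 1)} {V : List (Letter g)} (h : IsMarking β V)
    {a x : Letter g} (ha : a.1 ≠ Gen.t 0) (hx : x.1 ≠ Gen.t 0) :
    ∃ (σ : Letter g → Letter g) (β' : MulAut (F g 1)), Function.Injective σ ∧ σ a = x ∧
      (∀ s, σ (neg s) = neg (σ s)) ∧ (∀ s, s.1 ≠ a.1 → s.1 ≠ x.1 → σ s = s) ∧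
      (∀ L, β' (mk (L.map σ)) = β (mk L)) ∧ IsMarking β' (V.map σ) := by
  obtain ⟨σ, ρ, h1, h2, h3, h4, h5⟩ := exists_relabelling a x
  have hβ : ∀ L, (β * ρ) (mk (L.map σ)) = β (mk L) := fun L => by
    rw [MulAut.mul_apply, h5]
  have ht : σ tL = tL := h4 _ ha.symm hx.symm
  refine ⟨σ, β * ρ, h1.injective, h2, h3, h4, hβ, ?_⟩
  refine ⟨h.nodup.map h1.injective, fun s => ?_, ?_, (hβ V).trans h.map⟩
  · rw [List.mem_map]
    constructor
    · rintro ⟨r, hr, rfl⟩ e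
      refine (h.mem r).1 hr (h1.injective ?_)
      rw [e, h3, ht]
    · intro hs
      refine ⟨σ s, (h.mem _).2 fun e => hs ?_, h1 s⟩
      rw [← h1 s, e, h3, ht]
  · have := hβ [tL]
    rw [List.map_singleton, ht, mk_tL] at this
    rw [this]
    exact h.conj

theorem IsMarking.fst_ne_t {β : MulAut (F g 1)} {P Q : List (Letter g)}
    (h : IsMarking β (P ++ tL :: Q)) : ∀ s ∈ P ++ Q, s.1 ≠ Gen.t 0 := by
  intro s hs hst
  have hs' : s ∈ P ++ tL :: Q := by
    simp only [List.mem_append, List.mem_cons] at hs ⊢; tauto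
  rw [h.eq_tL hs' hst] at hs
  exact (List.nodup_cons.1 (List.perm_middle.nodup_iff.1 h.nodup)).1 hs

/-- Moving `t_1` to the front. -/
theorem IsMarking.front {β : MulAut (F g 1)} {P Q : List (Letter g)}
    (h : IsMarking β (P ++ tL :: Q)) : ∃ β' : MulAut (F g 1), IsMarking β' (tL :: (P ++ Q)) ∧
      β' (tt 0) = β (mk P * tt 0 * (mk P)⁻¹) ∧
      ∀ L : List (Letter g), (∀ s ∈ L, s.1 ≠ Gen.t 0) → β' (mk L) = β (mk L) := by
  have hP : ∀ s ∈ P, s.1 ≠ Gen.t 0 := fun s hs => h.fst_ne_t s (List.mem_append_left _ hs)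
  obtain ⟨E, h1, h2⟩ := exists_transvection (tL : Letter g) P (invRev P) hP (by
    intro s hs
    simp only [invRev, List.mem_reverse, List.mem_map] at hs
    obtain ⟨r, hr, rfl⟩ := hs
    exact hP r hr)
  rw [← inv_mk, mk_tL] at h1
  have hL : ∀ L : List (Letter g), (∀ s ∈ L, s.1 ≠ Gen.t 0) → E (mk L) = mk L :=
    fun L hL => aut_mk_eq_self fun s hs => h2 _ (hL s hs)
  have ht : (β * E) (tt 0) = β (mk P * tt 0 * (mk P)⁻¹) := by rw [MulAut.mul_apply, h1]
  refine ⟨β * E, h.of_perm List.perm_middle.symm ?_ ?_, ht, fun L hL' => by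
    rw [MulAut.mul_apply, hL L hL']⟩
  · rw [ht]
    refine h.conj.trans ?_
    rw [map_mul, map_mul, map_inv]
    exact isConj_iff.2 ⟨_, rfl⟩
  · rw [MulAut.mul_apply, mk_cons, map_mul, mk_tL, h1, hL _ h.fst_ne_t, mk_append, mk_append,
      mk_cons tL, mk_tL]
    congr 1
    group

/-- The classical cut and paste that moves a linked pair to the front as one commutator. The
hypothesis on P₀ Q₁ covers both positions of y, before x⁻¹ or after x. The substitution x ↦ S₁Q₃ x
P₀⁻¹, y ↦ S₁ y (S₁Q₃Q₂)⁻¹ turns [x, y] S₁Q₃Q₂S₂ into the old word, and x⁻¹y⁻¹x into the loop around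
the old pair x⁻¹, x; that value of the loop is what γ₁ needs later. -/
theorem IsMarking.split_handle {β : MulAut (F g 1)} {C P₀ Q₂ Q₃ Q₁ S₁ S₂ : List (Letter g)}
    {x y : Gen g 1} (hxt : x ≠ Gen.t 0) (hyt : y ≠ Gen.t 0) (hxy : x ≠ y)
    (h : IsMarking β (tL :: C ++ (P₀ ++ (x, false) :: (Q₂ ++ (y, false) :: Q₃) ++ (x, true) :: Q₁)))
    (hS : P₀ ++ Q₁ = S₁ ++ (y, true) :: S₂) :
    ∃ (β' : MulAut (F g 1)) (R' : List (Letter g)),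
      IsMarking β' (tL :: C ++ [(x, false), (y, false), (x, true), (y, true)] ++ R') ∧
      (∀ z, z ≠ x → z ≠ y → β' (of z) = β (of z)) ∧
      β' ((of x)⁻¹ * (of y)⁻¹ * of x) =
        β (mk (P₀ ++ (x, false) :: (Q₂ ++ (y, false) :: Q₃) ++ [(x, true)]) * (mk P₀)⁻¹) := by
  have hperm : (tL :: C ++ (P₀ ++ (x, false) :: (Q₂ ++ (y, false) :: Q₃) ++ (x, true) :: Q₁)).Perm
      ((x, false) :: (x, true) :: (y, false) :: (y, true) ::
        (tL :: C ++ (S₁ ++ (S₂ ++ (Q₂ ++ Q₃))))) := by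
    rw [List.perm_iff_count]
    intro s
    have := congrArg (List.count s) hS
    simp only [List.count_append, List.count_cons] at this ⊢
    omega
  have hnd := hperm.nodup_iff.1 h.nodup
  have hW : ∀ s ∈ tL :: C ++ (S₁ ++ (S₂ ++ (Q₂ ++ Q₃))), s.1 ≠ x ∧ s.1 ≠ y := by
    generalize tL :: C ++ (S₁ ++ (S₂ ++ (Q₂ ++ Q₃))) = W at hnd
    simp only [List.nodup_cons, List.mem_cons, not_or] at hnd
    rintro ⟨z, b⟩ hs
    constructor <;> rintro rfl <;> cases b <;> tauto
  simp only [List.mem_append] at hW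
  have hinv : ∀ {z : Gen g 1} {w : List (Letter g)}, (∀ s ∈ w, s.1 ≠ z) →
      ∀ s ∈ invRev w, s.1 ≠ z := by
    intro z w hw s hs
    simp only [invRev, List.mem_reverse, List.mem_map] at hs
    obtain ⟨r, hr, rfl⟩ := hs
    exact hw r hr
  have hP₀x : ∀ s ∈ P₀, s.1 ≠ x := by
    intro s hs
    have : s ∈ S₁ ++ (y, true) :: S₂ := hS ▸ List.mem_append_left _ hs
    simp only [List.mem_append, List.mem_cons] at this
    rcases this with h1 | rfl | h1
    · exact (hW s (by tauto)).1
    · exact hxy.symm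
    · exact (hW s (by tauto)).1
  obtain ⟨E₁, hE1, hE1'⟩ := exists_transvection ((x, true) : Letter g) (S₁ ++ Q₃) (invRev P₀)
    (by
      intro s hs
      rw [List.mem_append] at hs
      exact (hW s (by tauto)).1)
    (hinv hP₀x)
  obtain ⟨E₂, hE2, hE2'⟩ := exists_transvection ((y, true) : Letter g) S₁
    (invRev (S₁ ++ Q₃ ++ Q₂)) (fun s hs => (hW s (by tauto)).2)
    (hinv fun s hs => by
      simp only [List.mem_append] at hs
      exact (hW s (by tauto)).2)
  simp only [mk_true, ← inv_mk] at hE1 hE2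
  have hfix : ∀ z, z ≠ x → z ≠ y → (β * E₁ * E₂) (of z) = β (of z) := by
    intro z hx hy
    rw [MulAut.mul_apply, MulAut.mul_apply, hE2' z hy, hE1' z hx]
  have hfixL : ∀ L : List (Letter g), (∀ s ∈ L, s.1 ≠ x ∧ s.1 ≠ y) →
      (β * E₁ * E₂) (mk L) = β (mk L) := fun L hL =>
    aut_mk_congr fun s hs => hfix _ (hL s hs).1 (hL s hs).2
  have hE1L : ∀ L : List (Letter g), (∀ s ∈ L, s.1 ≠ x ∧ s.1 ≠ y) → E₁ (mk L) = mk L :=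
    fun L hL => aut_mk_eq_self fun s hs => hE1' _ (hL s hs).1
  have hX : (β * E₁ * E₂) (of x) = β (mk (S₁ ++ Q₃) * of x * (mk P₀)⁻¹) := by
    rw [MulAut.mul_apply, MulAut.mul_apply, hE2' x hxy, hE1]
  have hY : (β * E₁ * E₂) (of y) = β (mk S₁ * of y * (mk (S₁ ++ Q₃ ++ Q₂))⁻¹) := by
    rw [MulAut.mul_apply, MulAut.mul_apply, hE2, map_mul E₁, map_mul E₁, map_inv E₁, hE1' y hxy.symm,
      hE1L S₁ fun s hs => hW s (by tauto), hE1L _ fun s hs => hW s (by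
        simp only [List.mem_append] at hs; tauto)]
  have hPQ : mk P₀ * mk Q₁ = mk S₁ * (of y * mk S₂) := by
    rw [← mk_append, hS, mk_append, mk_cons, mk_true]
  refine ⟨β * E₁ * E₂, S₁ ++ Q₃ ++ Q₂ ++ S₂, h.of_perm ?_ ?_ ?_, hfix, ?_⟩
  · refine List.Perm.trans ?_ hperm.symm
    rw [List.perm_iff_count]
    intro s
    simp only [List.count_append, List.count_cons, List.count_nil]
    omega
  · rw [tt, hfix _ hxt.symm hyt.symm]
    exact h.conj
  · have e1 : mk [((x, false) : Letter g), (y, false), (x, true), (y, true)] =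
        (of x)⁻¹ * (of y)⁻¹ * of x * of y := by
      rw [mk_cons, mk_cons (y, false), mk_cons (x, true), mk_false, mk_false, mk_true, mk_true]
      group
    rw [mk_append, mk_append, map_mul, map_mul, hfixL _ fun s hs => hW s (Or.inl hs), e1, map_mul,
      map_mul, map_mul, map_inv, map_inv, hX, hY, hfixL _ fun s hs => hW s (by
        simp only [List.mem_append] at hs; tauto)]
    simp only [← map_inv, ← map_mul]
    congr 1
    simp only [mk_append, mk_cons_false, mk_cons_true]
    rw [show mk Q₁ = (mk P₀)⁻¹ * (mk S₁ * (of y * mk S₂)) by rw [← hPQ]; group]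
    group
  · rw [map_mul, map_mul, map_inv, map_inv, hX, hY]
    simp only [← map_inv, ← map_mul]
    congr 1
    simp only [mk_append, mk_cons_false, mk_cons_true, ← one_eq_mk]
    group

/-- One step in bringing the word of a marking to the form `V₀`. -/
theorem IsMarking.exists_next_handle {β : MulAut (F g 1)} {k : ℕ} (hk : k < g)
    {P₀ Q₀ Q₁ : List (Letter g)} {a : Letter g}
    (h : IsMarking β (tL :: commWord g k ++ (P₀ ++ a :: Q₀ ++ neg a :: Q₁))) :
    ∃ (β' : MulAut (F g 1)) (R' : List (Letter g)),
      IsMarking β' (tL :: commWord g (k + 1) ++ R') ∧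
      (∀ s ∈ tL :: commWord g k, β' (mk [s]) = β (mk [s])) ∧
      β' ((xx ⟨k, hk⟩)⁻¹ * (yy ⟨k, hk⟩)⁻¹ * xx ⟨k, hk⟩) =
        β (mk (P₀ ++ a :: Q₀ ++ [neg a]) * (mk P₀)⁻¹) := by
  set x : Gen g 1 := Gen.x ⟨k, hk⟩ with hx
  set y : Gen g 1 := Gen.y ⟨k, hk⟩ with hy
  have hxt : x ≠ Gen.t 0 := by simp [hx]
  have hyt : y ≠ Gen.t 0 := by simp [hy]
  have hxy : x ≠ y := by simp [hx, hy]
  have hC : ∀ s ∈ tL :: commWord g k, s.1 ≠ x ∧ s.1 ≠ y := by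
    intro s hs
    rcases List.mem_cons.1 hs with rfl | hs
    · exact ⟨hxt.symm, hyt.symm⟩
    · obtain ⟨i, hi, h' | h'⟩ := mem_commWord.1 hs <;> rw [h', hx, hy] <;>
        refine ⟨?_, ?_⟩ <;> simp only [ne_eq, Gen.x.injEq, Gen.y.injEq, reduceCtorEq,
          not_false_eq_true] <;> rintro rfl <;> simp at hi
  have hR : ∀ r ∈ P₀ ++ a :: Q₀ ++ neg a :: Q₁, ∀ s ∈ tL :: commWord g k, s.1 ≠ r.1 := by
    intro r hr s hs e
    have hd := List.disjoint_of_nodup_append h.nodup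
    refine hd (?_ : r ∈ _) hr
    rcases List.mem_cons.1 hs with rfl | hs
    · rw [h.eq_tL (List.mem_append_right _ hr) e.symm]
      exact List.mem_cons_self
    · rw [mem_commWord, e, ← mem_commWord] at hs
      exact List.mem_cons_of_mem _ hs
  have hat : a.1 ≠ Gen.t 0 := (hR a (by simp) tL List.mem_cons_self).symm
  -- A linked letter b supplies the second generator of the handle: a is renamed x⁻¹ and b is
  -- renamed y⁻¹.
  obtain ⟨b, hb, -, hbn⟩ := h.exists_linked (P := tL :: commWord g k ++ P₀) (Q := Q₀) (S := Q₁)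
    (a := a) (by simp) hat
  have hba : b ≠ a ∧ b ≠ neg a := by
    have hnd := h.nodup.of_append_right
    constructor <;> rintro rfl
    · have := hnd.of_append_left.of_append_right
      exact (List.nodup_cons.1 this).1 hb
    · exact List.disjoint_of_nodup_append hnd
        (List.mem_append_right _ (List.mem_cons_of_mem _ hb)) List.mem_cons_self
  obtain ⟨Q₂, Q₃, rfl⟩ := List.append_of_mem hb
  obtain ⟨σ, β₁, hσ, hσa, hσn, hσf, hβ₁, h₁⟩ := h.relabel (x := ((x, false) : Letter g)) hat hxt
  have hσC : ∀ s ∈ tL :: commWord g k, σ s = s := fun s hs =>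
    hσf s (hR a (by simp) s hs) (hC s hs).1
  have hσbx : (σ b).1 ≠ x := by
    intro e
    rcases eq_or_eq_neg (l := ((x, false) : Letter g)) e with e | e
    · exact hba.1 (hσ (e.trans hσa.symm))
    · exact hba.2 (hσ (by rw [hσn, hσa, e]))
  have hσb : ∀ s ∈ tL :: commWord g k, s.1 ≠ (σ b).1 := by
    intro s hs e
    rcases eq_or_eq_neg e with e | e
    · have : s = b := hσ (by rw [hσC s hs, e])
      exact hR b (by simp) s hs (by rw [this])
    · have : s = neg b := hσ (by rw [hσC s hs, hσn, e])
      exact hR b (by simp) s hs (by rw [this, neg_fst])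
  obtain ⟨τ, β₂, hτ, hτb, hτn, hτf, hβ₂, h₂⟩ := h₁.relabel (a := σ b)
    (x := ((y, false) : Letter g)) (hσb tL List.mem_cons_self).symm hyt
  have hτC : ∀ s ∈ tL :: commWord g k, τ s = s := fun s hs => hτf s (hσb s hs) (hC s hs).2
  have hτa : τ (σ a) = (x, false) := by rw [hσa, hτf _ hσbx.symm hxy]
  have hτa' : τ (σ (neg a)) = (x, true) := by rw [hσn, hτn, hτa]; rfl
  have hβ : ∀ L, β₂ (mk (L.map (τ ∘ σ))) = β (mk L) := fun L => by
    rw [← List.map_map, hβ₂, hβ₁]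
  have hCmap : (tL :: commWord g k).map (τ ∘ σ) = tL :: commWord g k := by
    conv_rhs => rw [← List.map_id (tL :: commWord g k)]
    refine List.map_congr_left fun s hs => ?_
    rw [Function.comp_apply, hσC s hs, hτC s hs, id]
  rw [List.map_map, List.map_append, hCmap] at h₂
  simp only [List.map_append, List.map_cons, Function.comp_apply, hτa, hτa', hτb] at h₂
  have hyR : ((y, true) : Letter g) ∈ P₀.map (τ ∘ σ) ++ Q₁.map (τ ∘ σ) := by
    have hm := h₂.mem_of_ne (s := (y, true)) hyt
    have hQ : ((y, true) : Letter g) ∉ (Q₂ ++ b :: Q₃).map (τ ∘ σ) := by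
      intro hm'
      have e : ((y, true) : Letter g) = (τ ∘ σ) (neg b) := by
        rw [Function.comp_apply, hσn, hτn, hτb]; rfl
      rw [e, List.mem_map_of_injective (hτ.comp hσ)] at hm'
      exact hbn hm'
    simp only [List.map_append, List.map_cons, Function.comp_apply, hτb] at hQ
    have hCy : ((y, true) : Letter g) ∉ tL :: commWord g k := fun hm' => (hC _ hm').2 rfl
    have hyx : ∀ c, ((y, true) : Letter g) ≠ (x, c) := fun c e => hxy (congrArg Prod.fst e).symm
    simp only [List.mem_append, List.mem_cons, hyx, false_or, not_or] at hm hQ hCy ⊢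
    tauto
  obtain ⟨S₁, S₂, hS⟩ := List.append_of_mem hyR
  obtain ⟨β', R', h₃, h4, h5⟩ := h₂.split_handle hxt hyt hxy hS
  refine ⟨β', R', ?_, ?_, ?_⟩
  · rw [commWord_succ hk, ← List.cons_append]
    exact h₃
  · intro s hs
    have e1 : β' (mk [s]) = β₂ (mk [s]) := aut_mk_congr fun r hr => by
      obtain rfl := List.mem_singleton.1 hr
      exact h4 _ (hC r hs).1 (hC r hs).2
    have e2 := hβ [s]
    rw [List.map_singleton, Function.comp_apply, hσC s hs, hτC s hs] at e2
    rw [e1, e2]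
  · rw [xx, yy, h5, map_mul, map_mul, map_inv, map_inv, hβ P₀]
    congr 1
    rw [← hβ]
    simp only [List.map_append, List.map_cons, Function.comp_apply, hτa, hτa', hτb, List.map_nil]

/-- Split off handles one at a time; each step leaves the values on t₁ and on earlier handles
unchanged. When all g handles are in place, no letters remain and the marking is an element of A. -/
theorem exists_mem_A (n : ℕ) :
    ∀ {β : MulAut (F g 1)} {k : ℕ} {R : List (Letter g)}, g - k = n → k ≤ g →
    IsMarking β (tL :: commWord g k ++ R) →
    ∃ θ ∈ A g 1, ∀ s ∈ tL :: commWord g k, θ (mk [s]) = β (mk [s]) := by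
  induction n with
  | zero =>
    intro β k R hn hk h
    obtain rfl : k = g := by omega
    have hR : R = [] := by
      refine List.eq_nil_iff_forall_not_mem.2 fun r hr => ?_
      refine List.disjoint_of_nodup_append h.nodup (?_ : r ∈ _) hr
      have := (isMarking_commWord (one_mem (A k 1))).mem r
      rw [this, ← h.mem]
      exact List.mem_append_right _ hr
    subst hR
    rw [List.append_nil] at h
    refine ⟨β, mem_A_iff.2 ⟨?_, h.conj⟩, fun _ _ => rfl⟩
    rw [← mk_cons_commWord, h.map, mk_cons_commWord]
  | succ n ih =>
    intro β k R hn hk h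
    have hk' : k < g := by omega
    have hx : ((Gen.x ⟨k, hk'⟩, true) : Letter g) ∈ R := by
      have hm := h.mem_of_ne (s := (Gen.x ⟨k, hk'⟩, true)) (by simp)
      refine (List.mem_append.1 hm).resolve_left fun hm => ?_
      rcases List.mem_cons.1 hm with hm | hm
      · simp [tL] at hm
      · obtain ⟨i, hi, h' | h'⟩ := mem_commWord.1 hm <;>
          simp only [Gen.x.injEq, reduceCtorEq] at h'
        simp [← h'] at hi
    obtain ⟨a, Q, rfl⟩ := List.exists_cons_of_ne_nil (List.ne_nil_of_mem hx)
    have haC : a ∉ tL :: commWord g k := fun hm =>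
      List.disjoint_of_nodup_append h.nodup hm List.mem_cons_self
    have hat : a.1 ≠ Gen.t 0 := fun e =>
      haC (by rw [h.eq_tL (by simp) e]; exact List.mem_cons_self)
    have hna : neg a ∈ Q := by
      have hm := h.mem_of_ne (s := neg a) hat
      rcases List.mem_append.1 hm with hm | hm
      · refine absurd ?_ haC
        rcases List.mem_cons.1 hm with hm | hm
        · exact absurd (congrArg Prod.fst hm) hat
        · rw [mem_commWord, neg_fst, ← mem_commWord] at hm
          exact List.mem_cons_of_mem _ hm
      · exact (List.mem_cons.1 hm).resolve_left (neg_ne_self a)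
    obtain ⟨Q₀, Q₁, rfl⟩ := List.append_of_mem hna
    obtain ⟨β', R', h1, h2, -⟩ := IsMarking.exists_next_handle hk' (P₀ := []) (a := a) (Q₀ := Q₀)
      (Q₁ := Q₁) (by simpa using h)
    obtain ⟨θ, hθ, h3⟩ := ih (by omega) hk' h1
    refine ⟨θ, hθ, fun s hs => (h3 s ?_).trans (h2 s hs)⟩
    rw [commWord_succ hk', ← List.cons_append]
    exact List.mem_append_left _ hs

/-- The element `x_1⁻¹ y_1⁻¹ x_1`. -/
def loop (hg : 1 ≤ g) : F g 1 := (xx ⟨0, hg⟩)⁻¹ * (yy ⟨0, hg⟩)⁻¹ * xx ⟨0, hg⟩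

/-- Every letter of a word `V` with `t_1` in front gives rise to a handle of the surface. -/
theorem IsMarking.exists_mem_A_loop (hg : 1 ≤ g) {β : MulAut (F g 1)} {P₀ Q₀ Q₁ : List (Letter g)}
    {a : Letter g} (h : IsMarking β (tL :: (P₀ ++ a :: Q₀ ++ neg a :: Q₁))) :
    ∃ θ ∈ A g 1, θ (tt 0) = β (tt 0) ∧
      θ (loop hg) = β (mk (P₀ ++ a :: Q₀ ++ [neg a]) * (mk P₀)⁻¹) := by
  obtain ⟨β', R', h1, h2, h3⟩ := IsMarking.exists_next_handle (k := 0) hg (P₀ := P₀) (a := a)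
    (Q₀ := Q₀) (Q₁ := Q₁) (by simpa [commWord] using h)
  obtain ⟨θ, hθ, h4⟩ := exists_mem_A _ rfl hg h1
  have h5 : ∀ s : Letter g, s ∈ commWord g 1 → θ (of s.1) = β' (of s.1) := by
    intro s hs
    refine h4 (s.1, true) (List.mem_cons_of_mem _ ?_)
    rw [mem_commWord] at hs ⊢
    exact hs
  refine ⟨θ, hθ, ?_, ?_⟩
  · rw [← mk_tL, h4 tL List.mem_cons_self, h2 tL List.mem_cons_self]
  · have ex : θ (xx ⟨0, hg⟩) = β' (xx ⟨0, hg⟩) := h5 (Gen.x ⟨0, hg⟩, true) (by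
      rw [mem_commWord]; exact ⟨⟨0, hg⟩, by simp, Or.inl rfl⟩)
    have ey : θ (yy ⟨0, hg⟩) = β' (yy ⟨0, hg⟩) := h5 (Gen.y ⟨0, hg⟩, true) (by
      rw [mem_commWord]; exact ⟨⟨0, hg⟩, by simp, Or.inr rfl⟩)
    rw [← h3, loop, map_mul, map_mul, map_inv, map_inv, ex, ey, map_mul, map_mul, map_inv, map_inv]

end normalForm

/-! ### The action of the generated subgroup on t₁ -/

section generation

variable {g : ℕ}

/-- The subgroup generated by the stabilizer of `t_1` and `γ_1`. -/
def genA (hg : 1 ≤ g) : Subgroup (MulAut (F g 1)) :=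
  Subgroup.closure ((stabA (tt (0 : Fin 1) : F g 1) : Set (MulAut (F g 1))) ∪ {γ₁ hg le_rfl})

/-- Since w₁ is t₁ followed by the loop, the factor t₁ commutes away under conjugation. -/
theorem γ₁_loop (hg : 1 ≤ g) :
    γ₁ hg le_rfl (tt 0) = (loop hg)⁻¹ * tt (0 : Fin 1) * loop hg := by
  have h : γ₁ hg le_rfl (tt 0) = (w₁ hg le_rfl)⁻¹ * tt (0 : Fin 1) * w₁ hg le_rfl := by
    change gammaHom (w₁ hg le_rfl) (of (Gen.t 0)) = _
    simp [gammaHom]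
  rw [h, w₁, loop, show (tt ⟨0, zero_lt_one⟩ : F g 1) = tt (0 : Fin 1) from rfl]
  group

theorem γ₁_inv_loop (hg : 1 ≤ g) : (γ₁ hg le_rfl)⁻¹ (tt 0) =
    (tt 0 * loop hg) * tt (0 : Fin 1) * (tt 0 * loop hg)⁻¹ := by
  have hw : (w₁ hg le_rfl : F g 1) = tt 0 * loop hg := by
    rw [w₁, loop, show (tt ⟨0, zero_lt_one⟩ : F g 1) = tt (0 : Fin 1) from rfl]
    group
  have h : γ₁ hg le_rfl (w₁ hg le_rfl : F g 1) = w₁ hg le_rfl :=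
    gammaHom_w₁ hg le_rfl _ (Commute.refl _)
  rw [MulAut.inv_apply, MulEquiv.symm_apply_eq, ← hw, map_mul, map_mul, map_inv, h, γ₁_loop, hw]
  group

theorem γ₁_mem_A (hg : 1 ≤ g) : γ₁ hg le_rfl ∈ A g 1 := by
  refine mem_A_iff.2 ⟨?_, ?_⟩
  · obtain ⟨n, rfl⟩ : ∃ n, g = n + 1 := ⟨g - 1, by omega⟩
    have e : V₀ (n + 1) 1 = w₁ hg le_rfl * (yy 0 *
        (List.ofFn fun i : Fin n => comm (xx i.succ : F (n + 1) 1) (yy i.succ)).prod) := by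
      rw [V₀_one, List.ofFn_succ, List.prod_cons, w₁, comm,
        show (⟨0, hg⟩ : Fin (n + 1)) = 0 from rfl, show (tt ⟨0, zero_lt_one⟩ : F (n + 1) 1) = tt (0 : Fin 1) from rfl]
      group
    have h : γ₁ hg le_rfl (w₁ hg le_rfl : F (n + 1) 1) = w₁ hg le_rfl :=
      gammaHom_w₁ hg le_rfl _ (Commute.refl _)
    have hx : ∀ i : Fin n, γ₁ hg le_rfl (xx i.succ : F (n + 1) 1) = xx i.succ := by
      intro i
      change gammaHom (w₁ hg le_rfl) (of (Gen.x i.succ)) = _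
      simp [gammaHom]
    have hy : ∀ i : Fin (n + 1), γ₁ hg le_rfl (yy i : F (n + 1) 1) = yy i := by
      intro i
      change gammaHom (w₁ hg le_rfl) (of (Gen.y i)) = _
      simp [gammaHom]
    have hc : (γ₁ hg le_rfl ∘ fun i : Fin n => comm (xx i.succ : F (n + 1) 1) (yy i.succ)) =
        fun i => comm (xx i.succ) (yy i.succ) := by
      funext i
      simp only [Function.comp, comm, map_mul, map_inv, hx, hy]
    rw [e, map_mul, map_mul, h, hy, map_list_prod, List.map_ofFn, hc]
  · rw [γ₁_loop]
    exact isConj_iff.2 ⟨(loop hg)⁻¹, by group⟩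

theorem genA_le (hg : 1 ≤ g) : genA hg ≤ A g 1 := by
  rw [genA, Subgroup.closure_le, Set.union_subset_iff, Set.singleton_subset_iff]
  exact ⟨fun φ hφ => hφ.1, γ₁_mem_A hg⟩

/-- The orbit of `t_1` under the subgroup `genA`. -/
def InOrbit (hg : 1 ≤ g) (u : F g 1) : Prop := ∃ ψ ∈ genA hg, ψ (tt 0) = u

theorem mem_genA_of_inOrbit (hg : 1 ≤ g) {φ : MulAut (F g 1)} (hφ : φ ∈ A g 1)
    (h : InOrbit hg (φ (tt 0))) : φ ∈ genA hg := by
  obtain ⟨ψ, hψ, e⟩ := h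
  have h1 : ψ⁻¹ * φ ∈ genA hg := by
    refine Subgroup.subset_closure (Or.inl (Subgroup.mem_inf.2
      ⟨mul_mem (inv_mem (genA_le hg hψ)) hφ, ?_⟩))
    change ψ⁻¹ (φ (tt 0)) = tt 0
    rw [← e]
    exact MulAut.inv_apply_self _ ψ _
  have := mul_mem hψ h1
  rwa [mul_inv_cancel_left] at this

/-- For elements of A, sending t₁ into the orbit is the same as lying in the subgroup, and this is
unaffected by right multiplication by δ. So δ may act on the inside, before θ. -/
theorem inOrbit_iff_of_mem_A (hg : 1 ≤ g) {θ : MulAut (F g 1)} (hθ : θ ∈ A g 1)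
    {δ : MulAut (F g 1)} (hδ : δ ∈ genA hg) :
    InOrbit hg (θ (δ (tt 0))) ↔ InOrbit hg (θ (tt 0)) := by
  constructor
  · intro h
    have h1 : θ * δ ∈ genA hg := mem_genA_of_inOrbit hg (mul_mem hθ (genA_le hg hδ)) h
    have h2 := mul_mem h1 (inv_mem hδ)
    rw [mul_inv_cancel_right] at h2
    exact ⟨θ, h2, rfl⟩
  · intro h
    exact ⟨θ * δ, mul_mem (mem_genA_of_inOrbit hg hθ h) hδ, rfl⟩

/-- Take θ in A agreeing with β on t₁ and sending the standard loop to β(c). The two equivalences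
come from θ γ₁ and θ γ₁⁻¹. -/
theorem IsMarking.inOrbit_conj_iff (hg : 1 ≤ g) {β : MulAut (F g 1)} {P₀ Q₀ Q₁ : List (Letter g)}
    {a : Letter g} (h : IsMarking β (tL :: (P₀ ++ a :: Q₀ ++ neg a :: Q₁))) {c : F g 1}
    (hc : c = mk (P₀ ++ a :: Q₀ ++ [neg a]) * (mk P₀)⁻¹) :
    (InOrbit hg (β (c⁻¹ * tt 0 * c)) ↔ InOrbit hg (β (tt 0))) ∧
    (InOrbit hg (β ((tt 0 * c) * tt 0 * (tt 0 * c)⁻¹)) ↔ InOrbit hg (β (tt 0))) := by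
  obtain ⟨θ, hθ, h1, h2⟩ := h.exists_mem_A_loop hg
  have hγ : γ₁ hg le_rfl ∈ genA hg := Subgroup.subset_closure (Or.inr rfl)
  have e1 := inOrbit_iff_of_mem_A hg hθ hγ
  have e2 := inOrbit_iff_of_mem_A hg hθ (inv_mem hγ)
  rw [γ₁_loop, map_mul, map_mul, map_inv, h2, h1, ← hc] at e1
  rw [γ₁_inv_loop, map_mul, map_mul, map_inv, map_mul, h2, h1, ← hc] at e2
  constructor
  · rw [← e1, map_mul, map_mul, map_inv]
  · rw [← e2, map_mul, map_mul, map_inv, map_mul]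

end generation

theorem mk_cons_neg {α : Type*} (s : α × Bool) (L : List (α × Bool)) :
    mk (neg s :: L) = (mk [s])⁻¹ * mk L := by rw [mk_cons, mk_neg]

/-! ### Nielsen moves on markings and their effect on the front arc -/

section moves

variable {g : ℕ}

/-- The substitution which deletes the letter `d` and replaces the letter `k` by the word `L`. -/
noncomputable def relocate (d k : Letter g) (L : List (Letter g)) (s : Letter g) :
    List (Letter g) :=
  if s = d then [] else if s = k then L else [s]

theorem flatMap_relocate_of_notMem {d k : Letter g} {L X : List (Letter g)} (hd : d ∉ X)
    (hk : k ∉ X) : X.flatMap (relocate d k L) = X := by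
  induction X with
  | nil => rfl
  | cons s X ih =>
    simp only [List.mem_cons, not_or] at hd hk
    rw [List.flatMap_cons, ih hd.2 hk.2, relocate, if_neg (Ne.symm hd.1), if_neg (Ne.symm hk.1),
      List.singleton_append]

theorem flatMap_relocate_perm {d k : Letter g} {L V : List (Letter g)} (hV : V.Nodup) (hd : d ∈ V)
    (hk : k ∈ V) (hdk : d ≠ k) (hL : L.Perm [d, k]) : (V.flatMap (relocate d k L)).Perm V := by
  have hk' : k ∈ V.erase d := (List.mem_erase_of_ne hdk.symm).2 hk
  have hp : V.Perm (d :: k :: (V.erase d).erase k) :=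
    (List.perm_cons_erase hd).trans ((List.perm_cons_erase hk').cons d)
  have hnd := hp.nodup_iff.1 hV
  simp only [List.nodup_cons, List.mem_cons, not_or] at hnd
  refine (hp.flatMap_right _).trans (List.Perm.trans ?_ hp.symm)
  rw [List.flatMap_cons, List.flatMap_cons, flatMap_relocate_of_notMem hnd.1.2 hnd.2.1, relocate,
    if_pos rfl, relocate, if_neg hdk.symm, if_pos rfl, List.nil_append]
  exact hL.append_right _

theorem aut_mk_flatMap_of_notMem {E : MulAut (F g 1)} {f : Letter g → List (Letter g)}
    {X : List (Letter g)} (h : ∀ s ∈ X, E (mk (f s)) = mk [s]) :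
    E (mk (X.flatMap f)) = mk X := by
  induction X with
  | nil => rw [List.flatMap_nil, ← one_eq_mk, map_one]
  | cons s X ih =>
    rw [List.flatMap_cons, mk_append, map_mul, h s List.mem_cons_self,
      ih fun r hr => h r (List.mem_cons_of_mem _ hr), ← mk_cons]

theorem aut_mk_flatMap_of_adjacent {E : MulAut (F g 1)} {f : Letter g → List (Letter g)}
    {l m : Letter g} {A B : List (Letter g)} (hnd : (A ++ l :: m :: B).Nodup)
    (hf : ∀ s, s ≠ l → s ≠ m → E (mk (f s)) = mk [s])
    (hlm : E (mk (f l)) * E (mk (f m)) = mk [l] * mk [m]) :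
    E (mk ((A ++ l :: m :: B).flatMap f)) = mk (A ++ l :: m :: B) := by
  have hp : (A ++ l :: m :: B).Perm (l :: m :: (A ++ B)) := by
    rw [List.perm_iff_count]
    intro s
    simp only [List.count_append, List.count_cons]
    omega
  have hnd' := hp.nodup_iff.1 hnd
  simp only [List.nodup_cons, List.mem_cons, List.mem_append, not_or] at hnd'
  have hA : E (mk (A.flatMap f)) = mk A := aut_mk_flatMap_of_notMem fun s hs =>
    hf s (by rintro rfl; tauto) (by rintro rfl; tauto)
  have hB : E (mk (B.flatMap f)) = mk B := aut_mk_flatMap_of_notMem fun s hs =>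
    hf s (by rintro rfl; tauto) (by rintro rfl; tauto)
  rw [List.flatMap_append, List.flatMap_cons, List.flatMap_cons, mk_append, mk_append, mk_append,
    map_mul, map_mul, map_mul, hA, hB, ← mul_assoc (E (mk (f l))), hlm, mk_append,
    mk_cons l (m :: B), mk_cons m B]
  group

/-- The arc obtained by moving `t_1` to the front lies in the orbit of `t_1`. -/
def FrontInOrbit (hg : 1 ≤ g) (β : MulAut (F g 1)) (V : List (Letter g)) : Prop :=
  ∀ P Q, V = P ++ tL :: Q → InOrbit hg (β (mk P * tt 0 * (mk P)⁻¹))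

theorem frontInOrbit_of_eq {hg : 1 ≤ g} {β : MulAut (F g 1)} {V P Q : List (Letter g)}
    (hnd : V.Nodup) (hV : V = P ++ tL :: Q) (h : InOrbit hg (β (mk P * tt 0 * (mk P)⁻¹))) :
    FrontInOrbit hg β V := by
  intro P' Q' hV'
  have hn : tL ∉ P ++ Q := (List.nodup_cons.1 (List.perm_middle.nodup_iff.1 (hV ▸ hnd))).1
  rw [List.mem_append, not_or] at hn
  obtain ⟨rfl, -, -⟩ := (List.append_cons_inj_of_notMem hn.1 hn.2).1 (hV.symm.trans hV')
  exact h

/-- As l and m are adjacent and neither is t₁, the prefix before t₁ contains both or neither, so the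
substitution preserves its value and the front arc is the same element. -/
theorem frontInOrbit_of_adjacent {hg : 1 ≤ g} {β E : MulAut (F g 1)}
    {f : Letter g → List (Letter g)} {V A B : List (Letter g)} {l m : Letter g} (hnd : V.Nodup)
    (hV : V = A ++ l :: m :: B) (hl : l ≠ tL) (hm : m ≠ tL)
    (hf : ∀ s, s ≠ l → s ≠ m → E (mk (f s)) = mk [s])
    (hlm : E (mk (f l)) * E (mk (f m)) = mk [l] * mk [m]) (hft : f tL = [tL])
    (h : FrontInOrbit hg (β * E) (V.flatMap f)) : FrontInOrbit hg β V := by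
  intro P Q hPQ
  have hE : E (tt 0) = tt 0 := by
    have := hf tL hl.symm hm.symm
    rwa [hft] at this
  have hP : E (mk (P.flatMap f)) = mk P := by
    rw [hV] at hPQ hnd
    rcases List.append_eq_append_iff.1 hPQ with ⟨D, rfl, h2⟩ | ⟨D, rfl, h2⟩
    · rcases D with _ | ⟨d, D⟩
      · simp only [List.nil_append, List.cons.injEq] at h2
        exact absurd h2.1 hl
      · rcases D with _ | ⟨e, D⟩
        · simp only [List.cons_append, List.nil_append, List.cons.injEq] at h2
          exact absurd h2.2.1 hm
        · simp only [List.cons_append, List.cons.injEq] at h2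
          obtain ⟨rfl, rfl, rfl⟩ := h2
          refine aut_mk_flatMap_of_adjacent ?_ hf hlm
          rw [← List.cons_append, ← List.cons_append, ← List.append_assoc] at hnd
          exact hnd.of_append_left
    · refine aut_mk_flatMap_of_notMem fun s hs => hf s ?_ ?_
      · rintro rfl
        rw [List.append_assoc] at hnd
        exact List.disjoint_of_nodup_append hnd hs (by simp)
      · rintro rfl
        rw [List.append_assoc] at hnd
        exact List.disjoint_of_nodup_append hnd hs (by simp)
  have := h (P.flatMap f) (Q.flatMap f) (by
    rw [hPQ, List.flatMap_append, List.flatMap_cons, hft, List.singleton_append])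
  rw [MulAut.mul_apply, map_mul E, map_mul E, map_inv E, hP, hE] at this
  exact this

theorem IsMarking.inOrbit_swallow_iff (hg : 1 ≤ g) {β : MulAut (F g 1)}
    {P Q P₀ Q₀ Q₁ : List (Letter g)} {a : Letter g} (h : IsMarking β (P ++ tL :: Q))
    (hPQ : P ++ Q = P₀ ++ a :: Q₀ ++ neg a :: Q₁) {u c : F g 1}
    (hu : u = mk P * tt 0 * (mk P)⁻¹)
    (hc : c = mk (P₀ ++ a :: Q₀ ++ [neg a]) * (mk P₀)⁻¹) :
    (InOrbit hg (β (c⁻¹ * u * c)) ↔ InOrbit hg (β u)) ∧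
    (InOrbit hg (β ((u * c) * u * (u * c)⁻¹)) ↔ InOrbit hg (β u)) := by
  obtain ⟨β', h1, h2, h3⟩ := h.front
  have hL := h.fst_ne_t
  rw [hPQ] at h1 hL
  have hβc : β' c = β c := by
    rw [hc, map_mul, map_mul, map_inv, map_inv, h3 _ fun s hs => hL s ?_,
      h3 P₀ fun s hs => hL s (by simp [hs])]
    simp only [List.mem_append, List.mem_cons, List.not_mem_nil, or_false] at hs ⊢
    tauto
  rw [← hu] at h2
  have := h1.inOrbit_conj_iff hg hc
  simpa only [map_mul, map_inv, hβc, h2] using this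

/-- The total weight of the images of the basis elements. -/
noncomputable def totalWeight (β : MulAut (F g 1)) : ℕ ×ₗ ℕ := ∑ z, weight (β (of z))

theorem weight_letter (β : MulAut (F g 1)) (s : Letter g) :
    weight (β (mk [s])) = weight (β (of s.1)) := by
  rcases mk_letter s with e | e <;> rw [e]
  rw [map_inv, weight_inv]

theorem totalWeight_lt {β E : MulAut (F g 1)} {s : Letter g}
    (hE : ∀ z ≠ s.1, E (of z) = of z) (h : weight (β (E (mk [s]))) < weight (β (mk [s]))) :
    totalWeight (β * E) < totalWeight β := by
  have h' : weight ((β * E) (of s.1)) < weight (β (of s.1)) := by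
    rw [← weight_letter, ← weight_letter]
    exact h
  refine Finset.sum_lt_sum (fun z _ => ?_) ⟨s.1, Finset.mem_univ _, h'⟩
  by_cases hz : z = s.1
  · rw [hz]; exact h'.le
  · rw [MulAut.mul_apply, hE z hz]

/-- There is a marking of smaller weight which leads to the same problem. -/
def Reducible (hg : 1 ≤ g) (β : MulAut (F g 1)) (V : List (Letter g)) : Prop :=
  ∃ β' V', IsMarking β' V' ∧ (FrontInOrbit hg β' V' → FrontInOrbit hg β V) ∧
    totalWeight β' < totalWeight β

variable {hg : 1 ≤ g} {β : MulAut (F g 1)} {V P Q : List (Letter g)} {l m : Letter g}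

/-- Replace l by l m. To keep the value of V, the letter m is removed after l and reinserted before
l⁻¹, where it cancels the new m⁻¹. -/
theorem IsMarking.reducible_right (h : IsMarking β V) (hV : V = P ++ l :: m :: Q)
    (hl : l.1 ≠ Gen.t 0) (hw : weight (β (mk [l]) * β (mk [m])) < weight (β (mk [l]))) :
    Reducible hg β V := by
  have hlm : l.1 ≠ m.1 := h.fst_ne_of_adjacent hV
  have hmV : m ∈ V := by simp [hV]
  have hnV : neg l ∈ V := h.mem_of_ne (by simpa using hl)
  have hmn : m ≠ neg l := fun e => hlm (by rw [e, neg_fst])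
  have hlm' : l ≠ m := fun e => hlm (by rw [e])
  have hlt : l ≠ tL := fun e => hl (by rw [e]; rfl)
  have hnt : (tL : Letter g) ≠ neg l := fun e => hl (by rw [← neg_fst, ← e]; rfl)
  obtain ⟨E, hE, hE'⟩ := exists_transvection l [] [m] (by simp) (by simpa using hlm.symm)
  rw [← one_eq_mk, one_mul] at hE
  have hEm : ∀ X : List (Letter g), (∀ s ∈ X, s.1 ≠ l.1) → E (mk X) = mk X := fun X hX =>
    aut_mk_eq_self fun s hs => hE' _ (hX s hs)
  have hEm' : ∀ X : List (Letter g), l ∉ X → neg l ∉ X → E (mk X) = mk X := by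
    refine fun X h1 h2 => hEm X fun s hs e => ?_
    rcases eq_or_eq_neg e with rfl | rfl <;> tauto
  have hEm1 : E (mk [m]) = mk [m] := hEm [m] (by simpa using hlm.symm)
  set f := relocate m (neg l) [m, neg l] with hf
  have hf1 : E (mk (f l)) = mk [l] * mk [m] := by
    rw [hf, relocate, if_neg hlm', if_neg (neg_ne_self l).symm, hE]
  have hf2 : E (mk (f m)) = 1 := by
    rw [hf, relocate, if_pos rfl, ← one_eq_mk, map_one]
  have hf3 : ∀ s, s ≠ l → s ≠ m → E (mk (f s)) = mk [s] := by
    intro s hsl hsm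
    rw [hf, relocate, if_neg hsm]
    split_ifs with hs
    · rw [mk_cons, mk_neg, map_mul, map_inv, hE, hEm1, hs, mk_neg]
      group
    · refine hEm [s] ?_
      rintro r hr e
      obtain rfl := List.mem_singleton.1 hr
      rcases eq_or_eq_neg e with e | e
      · exact hsl e
      · exact hs e
  have hfl : E (mk (f l)) * E (mk (f m)) = mk [l] * mk [m] := by rw [hf1, hf2, mul_one]
  have hnd := h.nodup
  have hEV : E (mk (V.flatMap f)) = mk V := by
    rw [hV] at hnd ⊢
    exact aut_mk_flatMap_of_adjacent hnd hf3 hfl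
  have hEt : E (tt 0) = tt 0 := hE' _ hl.symm
  refine ⟨β * E, V.flatMap f, h.of_perm
    (flatMap_relocate_perm hnd hmV hnV hmn (List.Perm.refl _)) ?_ ?_, ?_,
    totalWeight_lt hE' (by rw [hE, map_mul]; exact hw)⟩
  · rw [MulAut.mul_apply, hEt]
    exact h.conj
  · rw [MulAut.mul_apply, hEV]
  -- Only for m = t₁ does the front arc u change, because t₁ jumps next to l⁻¹. With c the loop
  -- around the pair l^{±1}, the new arc is c⁻¹uc if l⁻¹ comes before t₁ and (uc)u(uc)⁻¹ if it comes
  -- after.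
  by_cases hmt : m = tL
  · subst hmt
    have hQP : neg l ∈ P ∨ neg l ∈ Q := by
      rw [hV] at hnV
      simp only [List.mem_append, List.mem_cons, neg_ne_self, hnt.symm, false_or] at hnV
      exact hnV
    have hVt : V = (P ++ [l]) ++ tL :: Q := by rw [hV]; simp
    intro hfront
    refine frontInOrbit_of_eq hnd hVt ?_
    rw [hVt] at h
    rcases hQP with hQP | hQP
    · obtain ⟨R₀, R₁, rfl⟩ := List.append_of_mem hQP
      have hp : V.Perm (l :: neg l :: tL :: (R₀ ++ (R₁ ++ Q))) := by
        rw [hV, List.perm_iff_count]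
        intro s
        simp only [List.count_append, List.count_cons]
        omega
      have hnd' := hp.nodup_iff.1 hnd
      simp only [List.nodup_cons, List.mem_cons, List.mem_append, not_or] at hnd'
      obtain ⟨⟨-, -, l0, l1, l2⟩, ⟨-, n0, n1, n2⟩, ⟨t0, t1, t2⟩, -⟩ := hnd'
      have hVf : V.flatMap f = R₀ ++ tL :: (neg l :: R₁ ++ l :: Q) := by
        rw [hV]
        simp only [List.flatMap_append, List.flatMap_cons, hf,
          flatMap_relocate_of_notMem t0 n0, flatMap_relocate_of_notMem t1 n1,
          flatMap_relocate_of_notMem t2 n2]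
        simp [relocate, hlt, hmn.symm, (neg_ne_self l).symm]
      have := hfront _ _ hVf
      rw [MulAut.mul_apply, map_mul E, map_mul E, map_inv E, hEt, hEm' R₀ l0 n0] at this
      refine (h.inOrbit_swallow_iff hg (P₀ := R₀) (Q₀ := R₁) (Q₁ := Q) (a := neg l)
        (by simp) rfl rfl).1.1 ?_
      convert this using 2
      simp only [mk_append, mk_cons_neg, neg_neg_letter]
      group
    · obtain ⟨R₀, R₁, rfl⟩ := List.append_of_mem hQP
      have hp : V.Perm (l :: neg l :: tL :: (P ++ (R₀ ++ R₁))) := by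
        rw [hV, List.perm_iff_count]
        intro s
        simp only [List.count_append, List.count_cons]
        omega
      have hnd' := hp.nodup_iff.1 hnd
      simp only [List.nodup_cons, List.mem_cons, List.mem_append, not_or] at hnd'
      obtain ⟨⟨-, -, l0, l1, l2⟩, ⟨-, n0, n1, n2⟩, ⟨t0, t1, t2⟩, -⟩ := hnd'
      have hVf : V.flatMap f = (P ++ [l] ++ R₀) ++ tL :: (neg l :: R₁) := by
        rw [hV]
        simp only [List.flatMap_append, List.flatMap_cons, hf,
          flatMap_relocate_of_notMem t0 n0, flatMap_relocate_of_notMem t1 n1,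
          flatMap_relocate_of_notMem t2 n2]
        simp [relocate, hlt, hmn.symm, (neg_ne_self l).symm]
      have := hfront _ _ hVf
      rw [MulAut.mul_apply, map_mul E, map_mul E, map_inv E, hEt, mk_append, mk_append, map_mul E,
        map_mul E, hE, hEm' P l0 n0, hEm' R₀ l1 n1, mk_tL] at this
      refine (h.inOrbit_swallow_iff hg (P₀ := P) (Q₀ := R₀) (Q₁ := R₁) (a := l)
        (by simp) rfl rfl).2.1 ?_
      convert this using 2
      simp only [mk_append, mk_cons l R₀, mk_cons_neg, ← one_eq_mk]
      group
  · exact frontInOrbit_of_adjacent hnd hV hlt hmt hf3 hfl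
      (by rw [hf, relocate, if_neg (Ne.symm hmt), if_neg hnt])

end moves

section moves

variable {g : ℕ} {hg : 1 ≤ g} {β : MulAut (F g 1)} {V P Q : List (Letter g)} {l m : Letter g}

/-- The mirror image: m becomes l m, and l is reinserted after m⁻¹. -/
theorem IsMarking.reducible_left (h : IsMarking β V) (hV : V = P ++ l :: m :: Q)
    (hm : m.1 ≠ Gen.t 0) (hw : weight (β (mk [l]) * β (mk [m])) < weight (β (mk [m]))) :
    Reducible hg β V := by
  have hlm : l.1 ≠ m.1 := h.fst_ne_of_adjacent hV
  have hlV : l ∈ V := by simp [hV]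
  have hnV : neg m ∈ V := h.mem_of_ne (by simpa using hm)
  have hln : l ≠ neg m := fun e => hlm (by rw [e, neg_fst])
  have hlm' : l ≠ m := fun e => hlm (by rw [e])
  have hmt : m ≠ tL := fun e => hm (by rw [e]; rfl)
  have hnt : (tL : Letter g) ≠ neg m := fun e => hm (by rw [← neg_fst, ← e]; rfl)
  obtain ⟨E, hE, hE'⟩ := exists_transvection m [l] [] (by simpa using hlm) (by simp)
  rw [← one_eq_mk, mul_one] at hE
  have hEm : ∀ X : List (Letter g), (∀ s ∈ X, s.1 ≠ m.1) → E (mk X) = mk X := fun X hX =>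
    aut_mk_eq_self fun s hs => hE' _ (hX s hs)
  have hEm' : ∀ X : List (Letter g), m ∉ X → neg m ∉ X → E (mk X) = mk X := by
    refine fun X h1 h2 => hEm X fun s hs e => ?_
    rcases eq_or_eq_neg e with rfl | rfl <;> tauto
  have hEl : E (mk [l]) = mk [l] := hEm [l] (by simpa using hlm)
  set f := relocate l (neg m) [neg m, l] with hf
  have hf1 : E (mk (f l)) = 1 := by
    rw [hf, relocate, if_pos rfl, ← one_eq_mk, map_one]
  have hf2 : E (mk (f m)) = mk [l] * mk [m] := by
    rw [hf, relocate, if_neg hlm'.symm, if_neg (neg_ne_self m).symm, hE]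
  have hf3 : ∀ s, s ≠ l → s ≠ m → E (mk (f s)) = mk [s] := by
    intro s hsl hsm
    rw [hf, relocate, if_neg hsl]
    split_ifs with hs
    · rw [mk_cons, mk_neg, map_mul, map_inv, hE, hEl, hs, mk_neg]
      group
    · refine hEm [s] ?_
      rintro r hr e
      obtain rfl := List.mem_singleton.1 hr
      rcases eq_or_eq_neg e with e | e
      · exact hsm e
      · exact hs e
  have hfl : E (mk (f l)) * E (mk (f m)) = mk [l] * mk [m] := by rw [hf1, hf2, one_mul]
  have hnd := h.nodup
  have hEV : E (mk (V.flatMap f)) = mk V := by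
    rw [hV] at hnd ⊢
    exact aut_mk_flatMap_of_adjacent hnd hf3 hfl
  have hEt : E (tt 0) = tt 0 := hE' _ hm.symm
  refine ⟨β * E, V.flatMap f, h.of_perm
    (flatMap_relocate_perm hnd hlV hnV hln (List.Perm.swap _ _ _)) ?_ ?_, ?_,
    totalWeight_lt hE' (by rw [hE, map_mul]; exact hw)⟩
  · rw [MulAut.mul_apply, hEt]
    exact h.conj
  · rw [MulAut.mul_apply, hEV]
  by_cases hlt : l = tL
  · subst hlt
    have hQP : neg m ∈ P ∨ neg m ∈ Q := by
      rw [hV] at hnV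
      simp only [List.mem_append, List.mem_cons, neg_ne_self, hnt.symm, false_or] at hnV
      exact hnV
    intro hfront
    refine frontInOrbit_of_eq hnd hV ?_
    rw [hV] at h
    rcases hQP with hQP | hQP
    · obtain ⟨R₀, R₁, rfl⟩ := List.append_of_mem hQP
      have hp : V.Perm (m :: neg m :: tL :: (R₀ ++ (R₁ ++ Q))) := by
        rw [hV, List.perm_iff_count]
        intro s
        simp only [List.count_append, List.count_cons]
        omega
      have hnd' := hp.nodup_iff.1 hnd
      simp only [List.nodup_cons, List.mem_cons, List.mem_append, not_or] at hnd'
      obtain ⟨⟨-, -, m0, m1, m2⟩, ⟨-, n0, n1, n2⟩, ⟨t0, t1, t2⟩, -⟩ := hnd'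
      have hVf : V.flatMap f = (R₀ ++ [neg m]) ++ tL :: (R₁ ++ m :: Q) := by
        rw [hV]
        simp only [List.flatMap_append, List.flatMap_cons, hf,
          flatMap_relocate_of_notMem t0 n0, flatMap_relocate_of_notMem t1 n1,
          flatMap_relocate_of_notMem t2 n2]
        simp [relocate, hmt, hln.symm, (neg_ne_self m).symm]
      have := hfront _ _ hVf
      rw [MulAut.mul_apply, map_mul E, map_mul E, map_inv E, hEt, mk_append, mk_neg, map_mul E,
        map_inv E, hE, hEm' R₀ m0 n0, mk_tL] at this
      refine (h.inOrbit_swallow_iff hg (P₀ := R₀) (Q₀ := R₁) (Q₁ := Q) (a := neg m)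
        (by simp) rfl rfl).1.1 ?_
      convert this using 2
      simp only [mk_append, mk_cons_neg, neg_neg_letter]
      group
    · obtain ⟨R₀, R₁, rfl⟩ := List.append_of_mem hQP
      have hp : V.Perm (m :: neg m :: tL :: (P ++ (R₀ ++ R₁))) := by
        rw [hV, List.perm_iff_count]
        intro s
        simp only [List.count_append, List.count_cons]
        omega
      have hnd' := hp.nodup_iff.1 hnd
      simp only [List.nodup_cons, List.mem_cons, List.mem_append, not_or] at hnd'
      obtain ⟨⟨-, -, m0, m1, m2⟩, ⟨-, n0, n1, n2⟩, ⟨t0, t1, t2⟩, -⟩ := hnd'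
      have hVf : V.flatMap f = (P ++ [m] ++ R₀ ++ [neg m]) ++ tL :: R₁ := by
        rw [hV]
        simp only [List.flatMap_append, List.flatMap_cons, hf,
          flatMap_relocate_of_notMem t0 n0, flatMap_relocate_of_notMem t1 n1,
          flatMap_relocate_of_notMem t2 n2]
        simp [relocate, hmt, hln.symm, (neg_ne_self m).symm]
      have := hfront _ _ hVf
      rw [MulAut.mul_apply, map_mul E, map_mul E, map_inv E, hEt, mk_append, mk_append, mk_append,
        mk_neg, map_mul E, map_mul E, map_mul E, map_inv E, hE, hEm' P m0 n0, hEm' R₀ m1 n1,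
        mk_tL] at this
      refine (h.inOrbit_swallow_iff hg (P₀ := P) (Q₀ := R₀) (Q₁ := R₁) (a := m)
        (by simp) rfl rfl).2.1 ?_
      convert this using 2
      simp only [mk_append, mk_cons m R₀, mk_cons_neg, ← one_eq_mk]
      group
  · exact frontInOrbit_of_adjacent hnd hV hlt hmt hf3 hfl
      (by rw [hf, relocate, if_neg (Ne.symm hlt), if_neg hnt])

/-- The letter t₁ may not be multiplied, since its conjugacy class must be kept; it is conjugated
instead. This swaps t₁ with its neighbour in V and leaves the front arc literally unchanged. -/
theorem IsMarking.reducible_conj_right (h : IsMarking β V) (hV : V = P ++ l :: tL :: Q)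
    (hw : weight (β (mk [l]) * β (tt 0) * (β (mk [l]))⁻¹) < weight (β (tt 0))) :
    Reducible hg β V := by
  have hV' : V = (P ++ [l]) ++ tL :: Q := by simp [hV]
  have hfst := (hV' ▸ h).fst_ne_t
  obtain ⟨E, hE, hE'⟩ := exists_transvection (tL : Letter g) [l] [neg l]
    (by simpa [tL] using hfst l (by simp)) (by simpa [tL] using hfst l (by simp))
  rw [mk_neg] at hE
  have hEm : ∀ X : List (Letter g), (∀ s ∈ X, s.1 ≠ Gen.t 0) → E (mk X) = mk X := fun X hX =>
    aut_mk_eq_self fun s hs => hE' _ (hX s hs)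
  have hEP : E (mk P) = mk P := hEm P fun s hs => hfst s (by simp [hs])
  refine ⟨β * E, P ++ tL :: l :: Q, h.of_perm ?_ ?_ ?_, fun hfront => ?_,
    totalWeight_lt hE' ?_⟩
  · rw [hV]
    exact (List.Perm.swap _ _ _).append_left P
  · rw [MulAut.mul_apply, ← mk_tL, hE, map_mul, map_mul, map_inv]
    exact h.conj.trans (isConj_iff.2 ⟨_, rfl⟩)
  · rw [MulAut.mul_apply, mk_append, mk_cons tL, mk_cons l Q, map_mul E, map_mul E, map_mul E, hE,
      hEP, hEm [l] (by simpa using hfst l (by simp)), hEm Q fun s hs => hfst s (by simp [hs]), hV,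
      mk_append, mk_cons l (tL :: Q), mk_cons tL Q]
    congr 1
    group
  · refine frontInOrbit_of_eq h.nodup hV' ?_
    have := hfront P _ rfl
    rw [MulAut.mul_apply, map_mul E, map_mul E, map_inv E, hEP, ← mk_tL, hE] at this
    convert this using 2
    rw [mk_append, mk_tL]
    group
  · rw [hE, map_mul, map_mul, map_inv]
    exact hw

theorem IsMarking.reducible_conj_left (h : IsMarking β V) (hV : V = P ++ tL :: m :: Q)
    (hw : weight ((β (mk [m]))⁻¹ * β (tt 0) * β (mk [m])) < weight (β (tt 0))) :
    Reducible hg β V := by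
  have hfst := (hV ▸ h).fst_ne_t
  obtain ⟨E, hE, hE'⟩ := exists_transvection (tL : Letter g) [neg m] [m]
    (by simpa [tL] using hfst m (by simp)) (by simpa [tL] using hfst m (by simp))
  rw [mk_neg] at hE
  have hEm : ∀ X : List (Letter g), (∀ s ∈ X, s.1 ≠ Gen.t 0) → E (mk X) = mk X := fun X hX =>
    aut_mk_eq_self fun s hs => hE' _ (hX s hs)
  have hEP : E (mk P) = mk P := hEm P fun s hs => hfst s (by simp [hs])
  have hEl : E (mk [m]) = mk [m] := hEm [m] (by simpa using hfst m (by simp))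
  refine ⟨β * E, P ++ m :: tL :: Q, h.of_perm ?_ ?_ ?_, fun hfront => ?_,
    totalWeight_lt hE' ?_⟩
  · rw [hV]
    exact (List.Perm.swap _ _ _).append_left P
  · rw [MulAut.mul_apply, ← mk_tL, hE, map_mul, map_mul, map_inv]
    exact h.conj.trans (isConj_iff.2 ⟨(β (mk [m]))⁻¹, by rw [inv_inv]; rfl⟩)
  · rw [MulAut.mul_apply, mk_append, mk_cons m, mk_cons tL Q, map_mul E, map_mul E, map_mul E, hE,
      hEP, hEl, hEm Q fun s hs => hfst s (by simp [hs]), hV, mk_append, mk_cons tL (m :: Q),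
      mk_cons m Q]
    congr 1
    group
  · refine frontInOrbit_of_eq h.nodup hV ?_
    have := hfront (P ++ [m]) Q (by simp)
    rw [MulAut.mul_apply, map_mul E, map_mul E, map_inv E, mk_append, map_mul E, hEP, hEl, ← mk_tL,
      hE] at this
    convert this using 2
    rw [mk_tL]
    group
  · rw [hE, map_mul, map_mul, map_inv]
    exact hw

end moves

/-! ### Cancellation against a conjugate of a letter -/

section cancellation

variable {α : Type*} [DecidableEq α]

theorem exists_prefix_of_conj {w : FreeGroup α} {U p s : List (α × Bool)} {x : α × Bool}
    (hw : w.toWord = U ++ [x] ++ invRev U) (hw' : w.toWord = p ++ s)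
    (hp : 2 * p.length ≤ FreeGroup.norm w) : ∃ r, U = p ++ r := by
  have hn : FreeGroup.norm w = 2 * U.length + 1 := by
    rw [FreeGroup.norm, hw]
    simp only [List.length_append, FreeGroup.invRev_length, List.length_singleton]
    omega
  rw [hw', List.append_assoc] at hw
  rcases List.append_eq_append_iff.1 hw with ⟨r, h1, -⟩ | ⟨r, h1, -⟩
  · exact ⟨r, h1⟩
  · have : p.length = U.length + r.length := by rw [h1, List.length_append]
    have : r = [] := List.length_eq_zero_iff.1 (by omega)
    exact ⟨[], by rw [h1, this]; simp⟩

/-- The first bound puts the cancelled prefix p of w within its first half, hence inside U. The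
second says that p is replaced by something shorter; conjugation makes this replacement at both
ends. -/
theorem norm_conj_lt {w b : FreeGroup α} {U : List (α × Bool)} {x : α × Bool}
    (hw : w.toWord = U ++ [x] ++ invRev U) (h1 : FreeGroup.norm b ≤ FreeGroup.norm (b⁻¹ * w))
    (h2 : FreeGroup.norm (b⁻¹ * w) < FreeGroup.norm w) :
    FreeGroup.norm (b⁻¹ * w * b) < FreeGroup.norm w := by
  obtain ⟨p, A, B, e1, e2, e3⟩ := exists_cancellation b⁻¹ w
  have n1 : FreeGroup.norm b = A.length + p.length := by
    rw [← FreeGroup.norm_inv_eq, FreeGroup.norm, e1, List.length_append, FreeGroup.invRev_length]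
  have n2 : FreeGroup.norm w = p.length + B.length := by
    rw [FreeGroup.norm, e2, List.length_append]
  have n3 : FreeGroup.norm (b⁻¹ * w) = A.length + B.length := by
    rw [FreeGroup.norm, e3, List.length_append]
  obtain ⟨r, hr⟩ := exists_prefix_of_conj hw e2 (by omega)
  have hb : b⁻¹ = mk A * (mk p)⁻¹ := by
    rw [← FreeGroup.mk_toWord (x := b⁻¹), e1, inv_mk, mul_mk]
  have hb' : b = mk p * (mk A)⁻¹ := by rw [← inv_inv b, hb]; group
  have hw2 : w = mk (p ++ r ++ [x] ++ invRev (p ++ r)) := by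
    rw [← hr, ← hw, FreeGroup.mk_toWord]
  have e : b⁻¹ * w * b = mk (A ++ r ++ [x] ++ invRev (A ++ r)) := by
    rw [hb, hb', hw2]
    simp only [mk_append, ← inv_mk, mul_inv_rev]
    group
  have n4 : FreeGroup.norm w = 2 * (p.length + r.length) + 1 := by
    rw [FreeGroup.norm, hw, hr]
    simp only [List.length_append, FreeGroup.invRev_length, List.length_singleton]
    omega
  refine lt_of_le_of_lt (e ▸ FreeGroup.norm_mk_le) ?_
  simp only [List.length_append, FreeGroup.invRev_length, List.length_singleton]
  omega

/-- The outer entries 1 stand for missing neighbours, so at the two ends the triple condition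
reduces to a pair condition together with nontriviality. -/
theorem noTotalCancellation_of_pairs_of_triples {W : List (FreeGroup α)}
    (hne : ∀ w ∈ W, 0 < FreeGroup.norm w)
    (hpair : ∀ L₁ a b L₂, W = L₁ ++ a :: b :: L₂ →
      FreeGroup.norm a ≤ FreeGroup.norm (a * b) ∧ FreeGroup.norm b ≤ FreeGroup.norm (a * b))
    (htriple : ∀ L₁ a b d L₂, W = L₁ ++ a :: b :: d :: L₂ →
      FreeGroup.norm a + FreeGroup.norm d < FreeGroup.norm (a * b) + FreeGroup.norm (b * d)) :
    NoTotalCancellation (1 :: W ++ [1]) := by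
  intro L₁ a b d L₂ h
  rcases L₁ with _ | ⟨c, L₁⟩ <;> rcases List.eq_nil_or_concat L₂ with rfl | ⟨L₂, e, rfl⟩
  · simp only [List.cons_append, List.nil_append, List.cons.injEq] at h
    obtain ⟨rfl, h⟩ := h
    have h' : W ++ [1] = [b] ++ [d] := h
    obtain ⟨rfl, h2⟩ := List.append_inj' h' rfl
    obtain rfl : 1 = d := by simpa using h2
    have := hne b (by simp)
    simp only [FreeGroup.norm_one, one_mul, mul_one]
    omega
  · simp only [List.cons_append, List.nil_append, List.cons.injEq] at h
    obtain ⟨rfl, h⟩ := h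
    have h' : W ++ [1] = (b :: d :: L₂) ++ [e] := by rw [h]; simp
    obtain ⟨rfl, -⟩ := List.append_inj' h' rfl
    have h1 := hne b (by simp)
    have h2 := hpair [] b d L₂ rfl
    simp only [FreeGroup.norm_one, one_mul]
    omega
  · simp only [List.cons_append, List.cons.injEq] at h
    obtain ⟨-, h⟩ := h
    have h' : W ++ [1] = (L₁ ++ [a, b]) ++ [d] := by rw [h]; simp
    obtain ⟨rfl, h2⟩ := List.append_inj' h' rfl
    obtain rfl : 1 = d := by simpa using h2
    have h1 := hne b (by simp)
    have h2 := hpair L₁ a b [] rfl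
    simp only [FreeGroup.norm_one, mul_one]
    omega
  · simp only [List.cons_append, List.cons.injEq] at h
    obtain ⟨-, h⟩ := h
    have h' : W ++ [1] = (L₁ ++ a :: b :: d :: L₂) ++ [e] := by rw [h]; simp
    obtain ⟨rfl, -⟩ := List.append_inj' h' rfl
    exact htriple L₁ a b d L₂ rfl

variable [Fintype α]

theorem weight_mul_lt_of_code_lt {w b : FreeGroup α} {p q B : List (α × Bool)}
    (hw : w.toWord = q ++ B) (hb : b = mk p * (mk q)⁻¹) (hl : p.length = q.length)
    (h2 : 2 * q.length ≤ FreeGroup.norm w) (hc : code p < code q) : weight (b * w) < weight w := by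
  have e : b * w = mk (p ++ B) := by
    rw [hb, ← FreeGroup.mk_toWord (x := w), hw, mk_append, mk_append]
    group
  rw [e]
  exact weight_replace_prefix_lt hw hl h2 hc

theorem weight_conj_lt_of_code_lt {w b : FreeGroup α} {p q B U : List (α × Bool)} {x : α × Bool}
    (hw : w.toWord = q ++ B) (hwU : w.toWord = U ++ [x] ++ invRev U) (hb : b = mk p * (mk q)⁻¹)
    (hl : p.length = q.length) (h2 : 2 * q.length ≤ FreeGroup.norm w) (hc : code p < code q) :
    weight (b * w * b⁻¹) < weight w := by
  obtain ⟨s, rfl⟩ := exists_prefix_of_conj hwU hw h2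
  have e : b * w * b⁻¹ = mk (p ++ s ++ [x] ++ invRev (p ++ s)) := by
    rw [hb, ← FreeGroup.mk_toWord (x := w), hwU]
    simp only [mk_append, ← inv_mk, mul_inv_rev]
    group
  rw [e]
  exact weight_conj_replace_prefix_lt hwU hl hc

end cancellation

/-! ### Irreducible markings and the descent -/

section reduction

variable {g : ℕ} {hg : 1 ≤ g} {β : MulAut (F g 1)} {V P Q : List (Letter g)} {l m r : Letter g}

theorem isReduced_commWord {k : ℕ} (hk : k ≤ g) :
    FreeGroup.IsReduced (tL :: commWord g k) := by
  induction k with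
  | zero => simp [commWord]
  | succ k ih =>
    rw [commWord_succ hk, ← List.cons_append]
    refine List.isChain_append.2 ⟨ih (by omega), by simp, fun s hs r hr e => ?_⟩
    have hs' := List.mem_of_mem_getLast? hs
    simp only [List.head?_cons, Option.mem_def, Option.some.injEq] at hr
    subst hr
    rcases List.mem_cons.1 hs' with rfl | hs'
    · simp [tL] at e
    · obtain ⟨i, hi, h' | h'⟩ := mem_commWord.1 hs' <;> rw [h'] at e <;>
        simp only [Gen.x.injEq, reduceCtorEq] at e
      simp [e] at hi

theorem IsMarking.exists_toWord (h : IsMarking β V) :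
    ∃ U, (β (tt 0)).toWord = U ++ [tL] ++ invRev U :=
  exists_toWord_of_isConj h.conj

theorem toWord_inv_of_toWord {α : Type*} [DecidableEq α] {w : FreeGroup α} {U : List (α × Bool)}
    {x : α × Bool} (hw : w.toWord = U ++ [x] ++ invRev U) :
    w⁻¹.toWord = U ++ [neg x] ++ invRev U := by
  rw [FreeGroup.toWord_inv, hw, FreeGroup.invRev_append, FreeGroup.invRev_append,
    FreeGroup.invRev_invRev, List.append_assoc]
  simp [invRev, neg]

/-- A product shorter than a factor allows a move on that factor. For the factor t₁ the move is a
conjugation, and `norm_conj_lt` turns the shorter product into a shorter conjugate. -/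
theorem IsMarking.norm_le_of_not_reducible (h : IsMarking β V) (hred : ¬ Reducible hg β V)
    (hV : V = P ++ l :: m :: Q) :
    FreeGroup.norm (β (mk [l])) ≤ FreeGroup.norm (β (mk [l]) * β (mk [m])) ∧
      FreeGroup.norm (β (mk [m])) ≤ FreeGroup.norm (β (mk [l]) * β (mk [m])) := by
  obtain ⟨U, hU⟩ := h.exists_toWord
  have hlm := h.fst_ne_of_adjacent hV
  have hR : l.1 ≠ Gen.t 0 →
      FreeGroup.norm (β (mk [l])) ≤ FreeGroup.norm (β (mk [l]) * β (mk [m])) := fun hl => by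
    by_contra! hlt
    exact hred (h.reducible_right hV hl (weight_lt_of_norm_lt hlt))
  have hL : m.1 ≠ Gen.t 0 →
      FreeGroup.norm (β (mk [m])) ≤ FreeGroup.norm (β (mk [l]) * β (mk [m])) := fun hl => by
    by_contra! hlt
    exact hred (h.reducible_left hV hl (weight_lt_of_norm_lt hlt))
  by_cases hl : l.1 = Gen.t 0
  · obtain rfl := h.eq_tL (by simp [hV]) hl
    have hm : m.1 ≠ Gen.t 0 := fun e => hlm (hl.trans e.symm)
    refine ⟨?_, hL hm⟩
    by_contra! hlt
    have e : ((β (mk [m]))⁻¹ * (β (mk [tL]))⁻¹) = (β (mk [tL]) * β (mk [m]))⁻¹ := by group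
    have := norm_conj_lt (b := β (mk [m])) (toWord_inv_of_toWord hU)
      (by rw [← mk_tL, e, FreeGroup.norm_inv_eq]; exact hL hm)
      (by rw [← mk_tL, e, FreeGroup.norm_inv_eq, FreeGroup.norm_inv_eq]; exact hlt)
    rw [FreeGroup.norm_inv_eq, ← FreeGroup.norm_inv_eq] at this
    refine hred (h.reducible_conj_left hV (weight_lt_of_norm_lt ?_))
    convert this using 2
    group
  · refine ⟨hR hl, ?_⟩
    by_cases hm : m.1 = Gen.t 0
    · obtain rfl := h.eq_tL (by simp [hV]) hm
      by_contra! hlt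
      have := norm_conj_lt (b := (β (mk [l]))⁻¹) hU
        (by rw [inv_inv, ← mk_tL, FreeGroup.norm_inv_eq]; exact hR hl)
        (by rw [inv_inv, ← mk_tL]; exact hlt)
      refine hred (h.reducible_conj_right hV (weight_lt_of_norm_lt ?_))
      rwa [inv_inv] at this
    · exact hL hm

theorem IsMarking.norm_add_lt_of_not_reducible (h : IsMarking β V) (hred : ¬ Reducible hg β V)
    (hV : V = P ++ l :: m :: r :: Q) :
    FreeGroup.norm (β (mk [l])) + FreeGroup.norm (β (mk [r])) <
      FreeGroup.norm (β (mk [l]) * β (mk [m])) + FreeGroup.norm (β (mk [m]) * β (mk [r])) := by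
  have hV' : V = (P ++ [l]) ++ m :: r :: Q := by simp [hV]
  obtain ⟨U, hU⟩ := h.exists_toWord
  obtain ⟨h1, h2⟩ := h.norm_le_of_not_reducible hred hV
  obtain ⟨h3, h4⟩ := h.norm_le_of_not_reducible hred hV'
  obtain ⟨p, A, B, a1, a2, a3⟩ := exists_cancellation (β (mk [l])) (β (mk [m]))
  obtain ⟨q, A', B', b1, b2, b3⟩ := exists_cancellation (β (mk [m])) (β (mk [r]))
  by_contra! hcon
  have n1 := norm_eq_of_toWord a1
  have n2 := norm_eq_of_toWord a2
  have n3 := norm_eq_of_toWord a3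
  have n4 := norm_eq_of_toWord b1
  have n5 := norm_eq_of_toWord b2
  have n6 := norm_eq_of_toWord b3
  simp only [List.length_append, FreeGroup.invRev_length] at n1 n2 n3 n4 n5 n6
  -- The pair bounds let each neighbour cancel at most half of the middle factor. Total cancellation
  -- therefore means exactly half on each side: the middle factor is p q⁻¹ with |p| = |q|.
  obtain ⟨rfl, rfl⟩ := List.append_inj (a2.symm.trans b1) (by omega)
  have hlen : p.length = q.length := by omega
  have hm : β (mk [m]) = mk p * (mk q)⁻¹ := by
    rw [← FreeGroup.mk_toWord (x := β (mk [m])), b1, mk_append, inv_mk]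
  have hm1 : β (mk [m]) ≠ 1 := by
    intro e
    rw [map_eq_one_iff β β.injective, one_eq_mk] at e
    have := congrArg FreeGroup.norm e
    rw [← one_eq_mk, FreeGroup.norm_one] at this
    rcases mk_letter m with e' | e' <;> rw [e'] at this <;> simp at this
  have hpq : code p ≠ code q := fun e => hm1 (by rw [hm, code_inj hlen e, mul_inv_cancel])
  have hl' : (β (mk [l]))⁻¹.toWord = p ++ invRev A := by
    rw [FreeGroup.toWord_inv, a1, FreeGroup.invRev_append, FreeGroup.invRev_invRev]
  -- The tie-break: if p has the smaller code, the right neighbour's prefix q is exchanged for p.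
  -- Otherwise the prefix p of the inverse of the left neighbour is exchanged for q. The lengths do
  -- not grow, and the weight drops.
  rcases hpq.lt_or_gt with hc | hc
  · have hle : 2 * q.length ≤ FreeGroup.norm (β (mk [r])) := by omega
    by_cases hr : r.1 = Gen.t 0
    · obtain rfl := h.eq_tL (by simp [hV]) hr
      exact hred (h.reducible_conj_right hV' (weight_conj_lt_of_code_lt b2 hU hm hlen hle hc))
    · exact hred (h.reducible_left hV' hr (weight_mul_lt_of_code_lt b2 hm hlen hle hc))
  · have hm' : (β (mk [m]))⁻¹ = mk q * (mk p)⁻¹ := by rw [hm]; group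
    have hle : 2 * p.length ≤ FreeGroup.norm (β (mk [l]))⁻¹ := by
      rw [FreeGroup.norm_inv_eq]; omega
    by_cases hl : l.1 = Gen.t 0
    · obtain rfl := h.eq_tL (by simp [hV]) hl
      have := weight_conj_lt_of_code_lt hl' (toWord_inv_of_toWord hU) hm' hlen.symm hle hc
      rw [weight_inv, ← weight_inv] at this
      refine hred (h.reducible_conj_left hV ?_)
      convert this using 2
      · rw [mk_tL]
        group
      · rfl
    · have := weight_mul_lt_of_code_lt hl' hm' hlen.symm hle hc
      rw [weight_inv, ← weight_inv] at this
      refine hred (h.reducible_right hV hl ?_)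
      convert this using 2
      group

theorem map_mk_eq_prod {G : Type*} [Group G] {α : Type*} (χ : FreeGroup α →* G)
    (L : List (α × Bool)) : χ (mk L) = (L.map fun s => χ (mk [s])).prod := by
  induction L with
  | nil => rw [← one_eq_mk, map_one]; rfl
  | cons s L ih => rw [mk_cons, map_mul, ih, List.map_cons, List.prod_cons]

theorem IsMarking.frontInOrbit_of_not_reducible (h : IsMarking β V)
    (hred : ¬ Reducible hg β V) : FrontInOrbit hg β V := by
  intro P Q hV
  set a : Letter g → F g 1 := fun s => β (mk [s]) with ha
  have hNTC : NoTotalCancellation (1 :: V.map a ++ [1]) := by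
    refine noTotalCancellation_of_pairs_of_triples ?_ ?_ ?_
    · intro w hw
      obtain ⟨s, -, rfl⟩ := List.mem_map.1 hw
      rw [Nat.pos_iff_ne_zero, Ne, FreeGroup.norm_eq_zero, ha, map_eq_one_iff β β.injective]
      intro e
      have := congrArg FreeGroup.norm e
      rw [FreeGroup.norm_one] at this
      rcases mk_letter s with e' | e' <;> rw [e'] at this <;> simp at this
    · intro L₁ b c L₂ hL
      obtain ⟨V₁, V₂, e1, rfl, e2⟩ := List.map_eq_append_iff.1 hL
      obtain ⟨l, V₃, rfl, rfl, e3⟩ := List.map_eq_cons_iff.1 e2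
      obtain ⟨m, V₄, rfl, rfl, rfl⟩ := List.map_eq_cons_iff.1 e3
      exact h.norm_le_of_not_reducible hred e1
    · intro L₁ b c d L₂ hL
      obtain ⟨V₁, V₂, e1, rfl, e2⟩ := List.map_eq_append_iff.1 hL
      obtain ⟨l, V₃, rfl, rfl, e3⟩ := List.map_eq_cons_iff.1 e2
      obtain ⟨m, V₄, rfl, rfl, e4⟩ := List.map_eq_cons_iff.1 e3
      obtain ⟨r, V₅, rfl, rfl, rfl⟩ := List.map_eq_cons_iff.1 e4
      exact h.norm_add_lt_of_not_reducible hred e1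
  have hprod : (P.map a ++ a tL :: Q.map a).prod = V₀ g 1 := by
    rw [← List.map_cons, ← List.map_append, ← hV, ← h.map]
    exact (map_mk_eq_prod β.toMonoidHom V).symm
  rw [hV, List.map_append, List.map_cons, ← List.cons_append] at hNTC
  obtain ⟨X, X', M, p, q, hM, hw, hXMX, hX, hX', ⟨C, a₀, hC, hp⟩, d, D, hD, hq⟩ :=
    toWord_prod_of_noTotalCancellation _ _ _ (by simpa using hNTC)
  have hword : (V₀ g 1).toWord = tL :: commWord g g := by
    rw [← mk_cons_commWord, toWord_mk_of_isReduced (isReduced_commWord le_rfl)]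
  rw [hprod, hword] at hXMX
  have hone := isMarking_commWord (one_mem (A g 1))
  -- Both words list the same letters once. With at least one letter for each factor, the count
  -- leaves exactly one letter for M.
  have hlen : (tL :: commWord g g).length = V.length :=
    ((List.perm_ext_iff_of_nodup hone.nodup h.nodup).2 fun s => by
      rw [hone.mem, h.mem]).length_eq
  have hMpos := List.length_pos_iff.2 hM
  have hlen2 := congrArg List.length hXMX
  rw [hlen, hV] at hlen2
  simp only [List.length_append, List.length_cons, List.length_map] at hlen2 hX hX'
  obtain ⟨U, hU⟩ := h.exists_toWord
  have hpair : ∀ L₁ b c L₂, V.map a = L₁ ++ b :: c :: L₂ →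
      FreeGroup.norm b ≤ FreeGroup.norm (b * c) ∧ FreeGroup.norm c ≤ FreeGroup.norm (b * c) := by
    intro L₁ b c L₂ hL
    obtain ⟨V₁, V₂, e1, rfl, e2⟩ := List.map_eq_append_iff.1 hL
    obtain ⟨l, V₃, rfl, rfl, e3⟩ := List.map_eq_cons_iff.1 e2
    obtain ⟨m, V₄, rfl, rfl, rfl⟩ := List.map_eq_cons_iff.1 e3
    exact h.norm_le_of_not_reducible hred e1
  have hVmap : V.map a = P.map a ++ a tL :: Q.map a := by rw [hV]; simp
  -- At most half of β(t₁) = U t₁ U⁻¹ is lost on either side, so its only surviving letter is the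
  -- middle one: p = U and M is the single letter t₁.
  have hp' : 2 * p.length ≤ FreeGroup.norm (a tL) := by
    rcases C with _ | ⟨c, C⟩
    · simp only [List.nil_append, List.cons.injEq] at hC
      rw [← hC.1, one_mul, FreeGroup.norm_one] at hp
      omega
    · simp only [List.cons_append, List.cons.injEq] at hC
      rw [hC.2] at hVmap
      have := (hpair C a₀ (a tL) (Q.map a) (by rw [hVmap]; simp)).1
      omega
  have hq' : 2 * q.length ≤ FreeGroup.norm (a tL) := by
    rcases hQ : Q.map a with _ | ⟨c, W⟩
    · rw [hQ] at hD
      simp only [List.nil_append, List.cons.injEq] at hD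
      rw [← hD.1, mul_one, FreeGroup.norm_one] at hq
      omega
    · rw [hQ] at hD hVmap
      simp only [List.cons_append, List.cons.injEq] at hD
      rw [← hD.1] at hq
      have := (hpair _ _ _ _ hVmap).2
      omega
  have hU' : (a tL).toWord = U ++ [tL] ++ invRev U := hU
  have n1 := norm_eq_of_toWord hU'
  have n2 := norm_eq_of_toWord hw
  simp only [List.length_append, FreeGroup.invRev_length, List.length_singleton] at n1 n2
  rw [hU', List.append_assoc, List.append_assoc] at hw
  obtain ⟨hUp, hw⟩ := List.append_inj hw (by omega)
  obtain ⟨rfl, -⟩ := List.append_inj hw (by rw [List.length_singleton]; omega)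
  -- The letter t₁ occurs in the word of V₀ only at the front, so nothing precedes M and no factor
  -- precedes β(t₁).
  have hX0 : X = [] := by
    rcases X with _ | ⟨s, X⟩
    · rfl
    · simp only [List.cons_append, List.cons.injEq] at hXMX
      refine absurd ?_ (tL_notMem_commWord (g := g) g)
      rw [hXMX.2]
      simp
  have hP : P = [] := by
    rw [hX0] at hX
    exact List.length_eq_zero_iff.1 (by simpa using hX)
  subst hP
  -- As the first factor, β(t₁) has left neighbour 1 and loses nothing on the left, so U = p is
  -- empty.
  have hU0 : U = [] := by
    rcases C with _ | ⟨c, C⟩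
    · simp only [List.nil_append, List.cons.injEq] at hC
      rw [← hC.1, one_mul, FreeGroup.norm_one] at hp
      exact hUp.trans (List.length_eq_zero_iff.1 (by omega))
    · simp at hC
  have ht : β (tt 0) = tt 0 := by
    rw [← FreeGroup.mk_toWord (x := β (tt 0)), hU, hU0]
    rfl
  refine ⟨1, one_mem _, ?_⟩
  rw [← one_eq_mk, one_mul, inv_one, mul_one, ht]
  rfl

/-- The total weight lies in ℕ × ℕ with the lexicographic order, which is well founded, so the
descent ends at an irreducible marking. -/
theorem IsMarking.frontInOrbit (hg : 1 ≤ g) : ∀ {β : MulAut (F g 1)} {V : List (Letter g)},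
    IsMarking β V → FrontInOrbit hg β V := by
  intro β
  induction hw : totalWeight β using WellFoundedLT.induction generalizing β with
  | ind w ih =>
    intro V h
    by_cases hred : Reducible hg β V
    · obtain ⟨β', V', h1, h2, h3⟩ := hred
      exact h2 (ih _ (hw ▸ h3) rfl h1)
    · exact h.frontInOrbit_of_not_reducible hred

end reduction

end AlgMCG


theorem theorem3p3 (g : ℕ) (hg : 1 ≤ g) :
    Subgroup.closure
      ((AlgMCG.stabA (AlgMCG.tt (0 : Fin 1) : AlgMCG.F g 1) : Set (MulAut (AlgMCG.F g 1))) ∪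
        {AlgMCG.γ₁ hg le_rfl}) = AlgMCG.A g 1 := by
  refine le_antisymm (AlgMCG.genA_le hg) fun φ hφ => AlgMCG.mem_genA_of_inOrbit hg hφ ?_
  -- In the word of V₀ the letter t₁ is already in front, so with empty prefix the front arc is
  -- φ(t₁) itself.
  have := (AlgMCG.isMarking_commWord hφ).frontInOrbit hg [] _ rfl
  rwa [← FreeGroup.one_eq_mk, one_mul, inv_one, mul_one] at this
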